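/- Let $(\mathcal X,d)$ and $(\mathcal Y,\delta)$ be complete separable metric spaces, let $(\varepsilon_t)_{t\ge 2}$ be i.i.d. $\mathcal Y$-valued random variables on a probability space, and let $X_1$ be an $\mathcal X$-valued random variable independent of $(\varepsilon_t)_{t\ge2}$. Let $X_t=F_t(X_{t-1},\varepsilon_t)$ for $t\ge 2$, where the functions $F_t:\mathcal X\times\mathcal Y\to\mathcal X$ are measurable and satisfy, for some constant $\rho\in[0,1)$, $$\mathbb E\big[d(F_t(x,\varepsilon_t),F_t(x',\varepsilon_t))\big]\le \rho\, d(x,x')\qquad\text{for all } t\ge 2,\ x,x'\in\mathcal X .$$ (No Lipschitz condition of $F_t$ in its second argument is assumed.) Let $(X_1',(\varepsilon_t')_{t\ge2})$ be an independent copy of $(X_1,(\varepsilon_t)_{t\ge2})$. Let $n\ge 1$ and let $f:\mathcal X^n\to\mathbb R$ satisfy $|f(x_1,\dots,x_n)-f(x_1',\dots,x_n')|\le\sum_{t=1}^n d(x_t,x_t')$ for all $x_t,x_t'\in\mathcal X$. Assume that there are positive constants $M_1,\dots,M_n$ such that $$\|d(X_1,X_1')\|_\infty\le M_1\quad\text{and}\quad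 \big\|d\big(F_k(X_{k-1},\varepsilon_k),F_k(X_{k-1},\varepsilon_k')\big)\big\|_\infty\le M_k\quad\text{for } 2\le k\le n .$$ Put $K_t(\rho)=(1-\rho^{t+1})/(1-\rho)$ for $t\ge0$, $$D(n,\rho)=\sum_{k=1}^n K_{n-k}(\rho)M_k,\qquad M^2(n,\rho)=\sum_{k=1}^n\big(K_{n-k}(\rho)M_k\big)^2,$$ $$\ell(t)=(t-\ln t-1)+\frac{t}{e^t-1}+\ln(1-e^{-t})\quad (t>0),\qquad \ell(0)=0,$$ and $\ell^*(u)=\sup_{t>0}\,(ut-\ell(t))\in[0,+\infty]$ for $u\in[0,1]$ (so that $\ell^*(1)=+\infty$), with $\exp(-\infty)=0$. Then $f(X_1,\dots,X_n)$ is integrable, and $S_n=f(X_1,\dots,X_n)-\mathbb E[f(X_1,\dots,X_n)]$ satisfies, for each choice of the sign $\pm$: for every $s\ge 0$, $$\mathbb E\big[e^{\pm sS_n}\big]\le\exp\left(\frac{D^2(n,\rho)}{M^2(n,\rho)}\,\ell\left(\frac{M^2(n,\rho)\,s}{D(n,\rho)}\right)\right);$$ and for every $x\in[0,D(n,\rho)]$,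 $$\mathbb P(\pm S_n>x)\le\exp\left(-\frac{D^2(n,\rho)}{M^2(n,\rho)}\,\ell^*\left(\frac{x}{D(n,\rho)}\right)\right)\le\left(\frac{D(n,\rho)-x}{D(n,\rho)}\right)^{\frac{2D(n,\rho)x-x^2}{M^2(n,\rho)}} .$$ -/

import Mathlib

open MeasureTheory ProbabilityTheory
open scoped ENNReal

noncomputable section

namespace MarkovMcDiarmid

/-- `K_t(ρ) = (1 - ρ^(t+1)) / (1 - ρ)`, for `0 ≤ ρ < 1`. -/
def K (ρ : ℝ) (t : ℕ) : ℝ := (1 - ρ ^ (t + 1)) / (1 - ρ)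

/-- `D(n, ρ) = ∑_{k=1}^n K_{n-k}(ρ) M_k`. -/
def D (n : ℕ) (ρ : ℝ) (M : ℕ → ℝ) : ℝ :=
  ∑ k ∈ Finset.Icc 1 n, K ρ (n - k) * M k

/-- `M²(n, ρ) = ∑_{k=1}^n (K_{n-k}(ρ) M_k)²`. -/
def Msq (n : ℕ) (ρ : ℝ) (M : ℕ → ℝ) : ℝ :=
  ∑ k ∈ Finset.Icc 1 n, (K ρ (n - k) * M k) ^ 2

/-- Rio's function `ℓ(t) = (t - ln t - 1) + t (e^t - 1)⁻¹ + ln (1 - e^{-t})` for `t > 0`,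
extended by continuity to `ℓ(0) = 0`. Negative arguments are never used. -/
def ell (t : ℝ) : ℝ :=
  if t = 0 then 0
  else (t - Real.log t - 1) + t * (Real.exp t - 1)⁻¹ + Real.log (1 - Real.exp (-t))

/-- The Young transform `ℓ*(x) = sup_{t > 0} (x t - ℓ(t))`, with values in `[-∞, +∞]`:
it is `+∞` at `x = 1`. -/
def ellStar (x : ℝ) : EReal :=
  ⨆ t : Set.Ioi (0 : ℝ), ((x * t - ell t : ℝ) : EReal)

variable {Ω 𝒳 𝒴 : Type*}

/-- The vector `(X_1, …, X_n)` of the first `n` states. -/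
def path (n : ℕ) (X : ℕ → Ω → 𝒳) (ω : Ω) : Fin n → 𝒳 := fun i => X (i + 1) ω

/-- The innovation sequence `(ε_t)_{t ≥ 2}`. -/
def innov (ε : ℕ → Ω → 𝒴) (ω : Ω) : Set.Ici (2 : ℕ) → 𝒴 := fun t => ε t ω

/-- `S_n = f(X_1, …, X_n) - 𝔼 f(X_1, …, X_n)`. -/
def S [MeasurableSpace Ω] (μ : Measure Ω) (n : ℕ) (X : ℕ → Ω → 𝒳)
    (f : (Fin n → 𝒳) → ℝ) (ω : Ω) : ℝ :=
  f (path n X ω) - ∫ ω', f (path n X ω') ∂μ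

end MarkovMcDiarmid

end

noncomputable section

namespace MarkovMcDiarmid

/-! ### The Langevin function and the logarithm of `sinh h / h` -/

/-! Integrate out the innovations one at a time, starting from the last. If `f` is separately
Lipschitz with constant `κ` in its last variable and `1` in the others, then averaging over the last
innovation gives a function of the shorter trajectory with last constant `1 + ρκ`: the old state
contributes directly, and again through the contraction. Starting from `κ = 1` this recursion
produces the `K ρ j`. Given the past, the function oscillates in the new innovation by at most `K ρ
j` times the increment bound, so a Hoeffding lemma in its sharp one-sided form
(`lintegral_exp_le_ell`) costs a factor `exp (ell (s * K ρ j * M))`. The induction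
`integrable_and_lintegral_exp_le` multiplies these factors.

Write `Δ_k` for the products `K M_k`. The sum of the `ell (s Δ_k)` is then replaced by a single
value of `ell` (`sum_ell_le`). With `t = 2h`, `ell` equals `h * langevin h + logSinhc h`, where
`logSinhc` is a primitive of `langevin`. The Langevin function is concave by Lazarević's inequality,
so Jensen with weights `Δ_k / D` treats the first term, and integrating the same inequality treats
the second.

Chernoff's method then gives the rate `ellStar`. The explicit power bound amounts to `ellStar u ≥
(2u - u²) * (-log (1 - u))`, obtained by testing the supremum at `t = 4u` for `0 < u ≤ 2/5` and at
`t = 1/(1 - u)` for larger `u < 1`; the endpoints are limits `t → 0` and `t → ∞`. -/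

/-- The Langevin function `coth h - 1 / h`. -/
def langevin (h : ℝ) : ℝ := Real.cosh h / Real.sinh h - 1 / h

/-- The function `log (sinh h / h)`, a primitive of the Langevin function. -/
def logSinhc (h : ℝ) : ℝ := Real.log (Real.sinh h / h)

lemma ell_two_mul {h : ℝ} (hh : 0 < h) :
    ell (2 * h) = h * langevin h + logSinhc h := by
  have hs : 0 < Real.sinh h := Real.sinh_pos_iff.2 hh
  have hE : 1 < Real.exp (2 * h) := Real.one_lt_exp_iff.2 (by positivity)
  have e1 : Real.exp (2 * h) - 1 = 2 * Real.exp h * Real.sinh h := by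
    rw [Real.sinh_eq, two_mul, Real.exp_add]
    have : Real.exp h * Real.exp (-h) = 1 := by rw [← Real.exp_add]; simp
    linear_combination this
  have e2 : 1 - Real.exp (-(2 * h)) = 2 * Real.exp (-h) * Real.sinh h := by
    rw [Real.sinh_eq, two_mul, neg_add, Real.exp_add]
    have : Real.exp h * Real.exp (-h) = 1 := by rw [← Real.exp_add]; simp
    linear_combination -this
  have e3 : Real.log (1 - Real.exp (-(2 * h)))
      = Real.log 2 - h + Real.log (Real.sinh h) := by
    rw [e2, Real.log_mul (by positivity) hs.ne', Real.log_mul (by positivity) (by positivity),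
      Real.log_exp]
    ring
  have e4 : 2 * h * (Real.exp (2 * h) - 1)⁻¹ = h * (Real.cosh h / Real.sinh h) - h := by
    rw [e1]
    have e5 : Real.cosh h - Real.sinh h = Real.exp (-h) := Real.cosh_sub_sinh h
    have : h * (Real.cosh h / Real.sinh h) - h = h * Real.exp (-h) / Real.sinh h := by
      rw [← e5]; field_simp
    rw [this, Real.exp_neg]
    field_simp
  rw [ell, if_neg (by positivity), e3, e4, langevin, logSinhc, Real.log_div hs.ne' hh.ne',
    Real.log_mul (by norm_num) hh.ne']
  field_simp
  ring

/-- A function vanishing at `0` whose derivative is nonnegative on `(0, b)` is nonnegative on `[0, b]`. -/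
lemma nonneg_of_deriv_nonneg {f f' : ℝ → ℝ} {b : ℝ} (h0 : f 0 = 0)
    (hf : ∀ x, HasDerivAt f (f' x) x) (hf' : ∀ x, 0 < x → x < b → 0 ≤ f' x)
    {x : ℝ} (hx : 0 ≤ x) (hxb : x ≤ b) : 0 ≤ f x := by
  rw [← h0]
  refine monotoneOn_of_deriv_nonneg (convex_Icc 0 b)
    (fun y _ => (hf y).continuousAt.continuousWithinAt)
    (fun y _ => (hf y).differentiableAt.differentiableWithinAt) ?_
    ⟨le_rfl, hx.trans hxb⟩ ⟨hx, hxb⟩ hx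
  intro y hy
  rw [interior_Icc] at hy
  rw [(hf y).deriv]
  exact hf' y hy.1 hy.2

lemma sinh_le_mul_cosh {h : ℝ} (hh : 0 ≤ h) : Real.sinh h ≤ h * Real.cosh h := by
  rw [← sub_nonneg]
  refine nonneg_of_deriv_nonneg (f := fun x => x * Real.cosh x - Real.sinh x)
    (f' := fun x => x * Real.sinh x) (by simp) (fun x => ?_) (fun x hx _ => ?_) hh le_rfl
  · refine HasDerivAt.congr_deriv (((hasDerivAt_id x).mul (Real.hasDerivAt_cosh x)).sub (Real.hasDerivAt_sinh x)) ?_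
    simp
  · have := Real.sinh_pos_iff.2 hx
    positivity

/-- At `y = 2x` this is the sign of the derivative of `3 log (sinh x / x) - log (cosh x)`, the
function behind Lazarević's inequality. -/
lemma three_mul_sinh_le {y : ℝ} (hy : 0 ≤ y) :
    3 * Real.sinh y ≤ 2 * y + y * Real.cosh y := by
  rw [← sub_nonneg]
  refine nonneg_of_deriv_nonneg (f := fun x => 2 * x + x * Real.cosh x - 3 * Real.sinh x)
    (f' := fun x => 2 - 2 * Real.cosh x + x * Real.sinh x) (by simp) (fun x => ?_)
    (fun x hx _ => ?_) hy le_rfl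
  · refine HasDerivAt.congr_deriv ((((hasDerivAt_id x).const_mul 2).add
      ((hasDerivAt_id x).mul (Real.hasDerivAt_cosh x))).sub
      ((Real.hasDerivAt_sinh x).const_mul 3)) ?_
    simp; ring
  · refine nonneg_of_deriv_nonneg (f := fun x => 2 - 2 * Real.cosh x + x * Real.sinh x)
      (f' := fun x => x * Real.cosh x - Real.sinh x) (by simp) (fun x => ?_)
      (fun x hx _ => sub_nonneg.2 (sinh_le_mul_cosh hx.le)) hx.le le_rfl
    refine HasDerivAt.congr_deriv ((((Real.hasDerivAt_cosh x).const_mul 2).const_sub 2).add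
      ((hasDerivAt_id x).mul (Real.hasDerivAt_sinh x))) ?_
    simp; ring

lemma tendsto_sinh_div_self :
    Filter.Tendsto (fun x => Real.sinh x / x) (nhdsWithin 0 (Set.Ioi 0)) (nhds 1) := by
  have := (hasDerivAt_iff_tendsto_slope.1 (Real.hasDerivAt_sinh 0)).mono_left
    (nhdsWithin_mono 0 (fun x (hx : 0 < x) => hx.ne'))
  rw [Real.cosh_zero] at this
  refine this.congr (fun x => ?_)
  simp [slope_def_field]

/-- Lazarević's inequality `(sinh h / h)³ ≥ cosh h`. -/
lemma cube_mul_cosh_le {h : ℝ} (hh : 0 < h) :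
    h ^ 3 * Real.cosh h ≤ Real.sinh h ^ 3 := by
  have key : MonotoneOn (fun x => Real.log (Real.sinh x / x) * 3 - Real.log (Real.cosh x))
      (Set.Ioi 0) := by
    have hd : ∀ x : ℝ, 0 < x →
        HasDerivAt (fun x => Real.log (Real.sinh x / x) * 3 - Real.log (Real.cosh x))
        ((Real.cosh x * x - Real.sinh x * 1) / x ^ 2 / (Real.sinh x / x) * 3
          - Real.sinh x / Real.cosh x) x := by
      intro x hx
      have hs : 0 < Real.sinh x := Real.sinh_pos_iff.2 hx
      have hc : 0 < Real.cosh x := Real.cosh_pos x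
      exact ((((Real.hasDerivAt_sinh x).div (hasDerivAt_id x) hx.ne').log
        (div_pos hs hx).ne').mul_const 3).sub
        ((Real.hasDerivAt_cosh x).log hc.ne')
    refine monotoneOn_of_deriv_nonneg (convex_Ioi 0)
      (fun y hy => (hd y hy).continuousAt.continuousWithinAt)
      (fun y hy => (hd y (interior_subset hy)).differentiableAt.differentiableWithinAt) ?_
    intro x hx
    have hx : 0 < x := interior_subset hx
    rw [(hd x hx).deriv]
    have hs : 0 < Real.sinh x := Real.sinh_pos_iff.2 hx
    have hc : 0 < Real.cosh x := Real.cosh_pos x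
    have h2 := three_mul_sinh_le (y := 2 * x) (by positivity)
    rw [Real.sinh_two_mul, Real.cosh_two_mul] at h2
    have hcs := Real.cosh_sq x
    have : (Real.cosh x * x - Real.sinh x * 1) / x ^ 2 / (Real.sinh x / x) * 3
          - Real.sinh x / Real.cosh x
        = (3 * x * Real.cosh x ^ 2 - 3 * Real.sinh x * Real.cosh x - x * Real.sinh x ^ 2) /
          (x * Real.sinh x * Real.cosh x) := by
      field_simp
    rw [this]
    apply div_nonneg _ (by positivity)
    nlinarith
  have hlim : Filter.Tendsto (fun x => Real.log (Real.sinh x / x) * 3 - Real.log (Real.cosh x))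
      (nhdsWithin 0 (Set.Ioi 0)) (nhds 0) := by
    have h1 := tendsto_sinh_div_self
    have h2 : Filter.Tendsto (fun x => Real.cosh x) (nhdsWithin 0 (Set.Ioi 0)) (nhds 1) := by
      rw [← Real.cosh_zero]
      exact (Real.continuous_cosh.tendsto 0).mono_left nhdsWithin_le_nhds
    have := ((h1.log one_ne_zero).mul_const 3).sub (h2.log one_ne_zero)
    simpa using this
  -- An increasing function on the open half-line dominates its limit at `0`.
  have hnn : 0 ≤ Real.log (Real.sinh h / h) * 3 - Real.log (Real.cosh h) := by
    refine le_of_tendsto hlim ?_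
    filter_upwards [Ioo_mem_nhdsGT hh] with x hx
    exact key hx.1 hh hx.2.le
  have hs : 0 < Real.sinh h := Real.sinh_pos_iff.2 hh
  have hc : 0 < Real.cosh h := Real.cosh_pos h
  have : Real.log (Real.cosh h) ≤ Real.log ((Real.sinh h / h) ^ 3) := by
    rw [Real.log_pow]; push_cast; linarith
  rw [Real.log_le_log_iff hc (by positivity), div_pow, le_div_iff₀ (by positivity)] at this
  linarith

lemma hasDerivAt_langevin {h : ℝ} (hh : 0 < h) :
    HasDerivAt langevin (1 / h ^ 2 - 1 / Real.sinh h ^ 2) h := by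
  have hs : 0 < Real.sinh h := Real.sinh_pos_iff.2 hh
  have h1 := ((Real.hasDerivAt_cosh h).div (Real.hasDerivAt_sinh h) hs.ne').sub
    (hasDerivAt_inv hh.ne')
  have : langevin = fun x => Real.cosh x / Real.sinh x - x⁻¹ := by
    funext x; simp [langevin]
  rw [this]
  refine h1.congr_deriv ?_
  have := Real.cosh_sq h
  field_simp
  linear_combination -h ^ 2 * this

/-- The second derivative is `2 (cosh x / sinh³ x - 1 / x³)`, whose sign is exactly Lazarević's
inequality. -/
lemma concaveOn_langevin : ConcaveOn ℝ (Set.Ioi 0) langevin := by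
  have hd2 : ∀ x : ℝ, 0 < x → HasDerivAt (fun h : ℝ => 1 / h ^ 2 - 1 / Real.sinh h ^ 2)
      (-2 / x ^ 3 + 2 * Real.cosh x / Real.sinh x ^ 3) x := by
    intro x hx
    have hs : 0 < Real.sinh x := Real.sinh_pos_iff.2 hx
    have h1 := (((hasDerivAt_id x).pow 2).inv (by simp only [id, Pi.pow_apply]; positivity)).sub
      (((Real.hasDerivAt_sinh x).pow 2).inv (by simp only [Pi.pow_apply]; positivity))
    simp only [one_div]
    refine h1.congr_deriv ?_
    simp only [id, Pi.pow_apply]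
    field_simp
    ring
  refine concaveOn_of_hasDerivWithinAt2_nonpos (convex_Ioi 0)
    (f' := fun h : ℝ => 1 / h ^ 2 - 1 / Real.sinh h ^ 2)
    (f'' := fun x => -2 / x ^ 3 + 2 * Real.cosh x / Real.sinh x ^ 3)
    (fun x hx => (hasDerivAt_langevin hx).continuousAt.continuousWithinAt) ?_ ?_ ?_
  · intro x hx
    exact (hasDerivAt_langevin (interior_subset hx)).hasDerivWithinAt
  · intro x hx
    exact (hd2 x (interior_subset hx)).hasDerivWithinAt
  · intro x hx
    have hx : 0 < x := interior_subset hx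
    have hs : 0 < Real.sinh x := Real.sinh_pos_iff.2 hx
    have := cube_mul_cosh_le hx
    have e : -2 / x ^ 3 + 2 * Real.cosh x / Real.sinh x ^ 3
        = 2 * (x ^ 3 * Real.cosh x - Real.sinh x ^ 3) / (x ^ 3 * Real.sinh x ^ 3) := by
      field_simp; ring
    rw [e]
    exact div_nonpos_of_nonpos_of_nonneg (by linarith) (by positivity)

/-- The conventions `0 / 0 = 0` and `log 0 = 0` happen to give the value of the continuous
extension. -/
lemma logSinhc_zero : logSinhc 0 = 0 := by simp [logSinhc]

lemma hasDerivAt_logSinhc {h : ℝ} (hh : 0 < h) : HasDerivAt logSinhc (langevin h) h := by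
  have hs : 0 < Real.sinh h := Real.sinh_pos_iff.2 hh
  have h1 := ((Real.hasDerivAt_sinh h).div (hasDerivAt_id h) hh.ne').log
        (div_pos hs hh).ne'
  refine h1.congr_deriv ?_
  simp only [Pi.div_apply, id, langevin]
  field_simp

lemma continuousOn_logSinhc : ContinuousOn logSinhc (Set.Ici 0) := by
  intro x hx
  rcases (Set.mem_Ici.1 hx).eq_or_lt with rfl | hx
  · have h1 := tendsto_sinh_div_self
    have h2 := h1.log one_ne_zero
    rw [Real.log_one] at h2
    refine continuousWithinAt_Ioi_iff_Ici.1 ?_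
    rw [ContinuousWithinAt, logSinhc_zero]
    exact h2
  · exact (hasDerivAt_logSinhc hx).continuousAt.continuousWithinAt

/-- Rio's inequality: the sum of the functions `ℓ(Δ_k s)` is controlled by one dilation of `ℓ`. -/
lemma sum_ell_le {ι : Type*} (I : Finset ι) (hI : I.Nonempty) (Δ : ι → ℝ)
    (hΔ : ∀ i ∈ I, 0 < Δ i) {s : ℝ} (hs : 0 ≤ s) :
    ∑ i ∈ I, ell (s * Δ i) ≤ (∑ i ∈ I, Δ i) ^ 2 / (∑ i ∈ I, Δ i ^ 2) *
      ell ((∑ i ∈ I, Δ i ^ 2) * s / ∑ i ∈ I, Δ i) := by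
  set D := ∑ i ∈ I, Δ i with hD
  set V := ∑ i ∈ I, Δ i ^ 2 with hV
  have hDpos : 0 < D := Finset.sum_pos hΔ hI
  have hVpos : 0 < V := Finset.sum_pos (fun i hi => pow_pos (hΔ i hi) 2) hI
  rcases hs.eq_or_lt with rfl | hs
  · simp [ell]
  -- Jensen with weights `Δ i / D` at the points `h * Δ i`, whose barycentre is `V * h / D`.
  have jensen : ∀ h : ℝ, 0 < h →
      ∑ i ∈ I, Δ i * langevin (h * Δ i) ≤ D * langevin (V * h / D) := by
    intro h hh
    have := concaveOn_langevin.le_map_sum (t := I) (w := fun i => Δ i / D)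
      (p := fun i => h * Δ i) (fun i hi => (div_pos (hΔ i hi) hDpos).le)
      (by rw [← Finset.sum_div, div_self hDpos.ne']) (fun i hi => mul_pos hh (hΔ i hi))
    simp only [smul_eq_mul] at this
    have e1 : ∑ i ∈ I, Δ i / D * (h * Δ i) = V * h / D := by
      rw [hV, Finset.sum_mul, Finset.sum_div]
      exact Finset.sum_congr rfl (fun i _ => by ring)
    have e2 : ∑ i ∈ I, Δ i * langevin (h * Δ i)
        = D * ∑ i ∈ I, Δ i / D * langevin (h * Δ i) := by
      rw [Finset.mul_sum]
      exact Finset.sum_congr rfl (fun i _ => by field_simp)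
    rw [e2]
    rw [e1] at this
    exact mul_le_mul_of_nonneg_left this hDpos.le
  -- This is `jensen` integrated from `0` to `h`; the factor `D ^ 2 / V` makes the derivative of the
  -- right side `D * langevin (V * h / D)`.
  have primitive : ∀ h : ℝ, 0 ≤ h →
      ∑ i ∈ I, logSinhc (h * Δ i) ≤ D ^ 2 / V * logSinhc (V * h / D) := by
    intro h hh
    have hd : ∀ x : ℝ, 0 < x → HasDerivAt
        (fun x => D ^ 2 / V * logSinhc (V * x / D) - ∑ i ∈ I, logSinhc (x * Δ i))
        (D * langevin (V * x / D) - ∑ i ∈ I, Δ i * langevin (x * Δ i)) x := by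
      intro x hx
      have h1 : HasDerivAt (fun x => D ^ 2 / V * logSinhc (V * x / D))
          (D ^ 2 / V * (langevin (V * x / D) * (V * 1 / D))) x :=
        (HasDerivAt.comp x (hasDerivAt_logSinhc (by positivity : 0 < V * x / D))
          (((hasDerivAt_id x).const_mul V).div_const D)).const_mul _
      have h2 : HasDerivAt (fun x => ∑ i ∈ I, logSinhc (x * Δ i))
          (∑ i ∈ I, langevin (x * Δ i) * (1 * Δ i)) x :=
        HasDerivAt.fun_sum (fun i hi => HasDerivAt.comp (h₂ := logSinhc) x
          (hasDerivAt_logSinhc (mul_pos hx (hΔ i hi))) ((hasDerivAt_id x).mul_const (Δ i)))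
      refine (h1.sub h2).congr_deriv ?_
      congr 1
      · field_simp
      · exact Finset.sum_congr rfl (fun i _ => by ring)
    have hc : ContinuousOn
        (fun x => D ^ 2 / V * logSinhc (V * x / D) - ∑ i ∈ I, logSinhc (x * Δ i)) (Set.Ici 0) := by
      refine ContinuousOn.sub (continuousOn_const.mul (continuousOn_logSinhc.comp
        (by fun_prop) ?_)) (continuousOn_finsetSum _ (fun i hi => continuousOn_logSinhc.comp
        (by fun_prop) ?_))
      · intro x (hx : 0 ≤ x)
        exact (by positivity : 0 ≤ V * x / D)
      · intro x (hx : 0 ≤ x)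
        exact mul_nonneg hx (hΔ i hi).le
    have hm := monotoneOn_of_deriv_nonneg (convex_Ici 0) hc
      (fun x hx => by
        rw [interior_Ici] at hx
        exact (hd x hx).differentiableAt.differentiableWithinAt)
      (fun x hx => by
        rw [interior_Ici] at hx
        rw [(hd x hx).deriv]
        exact sub_nonneg.2 (jensen x hx)) Set.self_mem_Ici hh hh
    simp only [zero_mul, mul_zero, zero_div, logSinhc_zero, Finset.sum_const_zero, sub_zero] at hm
    linarith
  have hh : 0 < s / 2 := by positivity
  have e1 : ∀ i ∈ I, ell (s * Δ i)
      = s / 2 * (Δ i * langevin (s / 2 * Δ i)) + logSinhc (s / 2 * Δ i) := by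
    intro i hi
    have := ell_two_mul (mul_pos hh (hΔ i hi))
    rw [show 2 * (s / 2 * Δ i) = s * Δ i by ring] at this
    rw [this]; ring
  have e2 : ell (V * s / D)
      = V * (s / 2) / D * langevin (V * (s / 2) / D) + logSinhc (V * (s / 2) / D) := by
    rw [← ell_two_mul (by positivity)]; congr 1; ring
  rw [Finset.sum_congr rfl e1, Finset.sum_add_distrib, ← Finset.mul_sum, e2, mul_add]
  refine add_le_add ?_ (primitive _ hh.le)
  calc s / 2 * ∑ i ∈ I, Δ i * langevin (s / 2 * Δ i)
      ≤ s / 2 * (D * langevin (V * (s / 2) / D)) :=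
        mul_le_mul_of_nonneg_left (jensen _ hh) hh.le
    _ = _ := by field_simp

/-! ### The Laplace transform of a centered Bernoulli variable -/

lemma bernoulli_mgf_le {p t : ℝ} (hp : 0 ≤ p) (ht : 0 ≤ t) :
    Real.exp (-(p * t)) * (1 + p * (Real.exp t - 1)) ≤ Real.exp (ell t) := by
  rcases ht.eq_or_lt with rfl | ht
  · simp [ell]
  have hE : 0 < Real.exp t - 1 := by linarith [Real.one_lt_exp_iff.2 ht]
  have hz : 0 < 1 + p * (Real.exp t - 1) := by positivity
  rw [← Real.exp_log hz, ← Real.exp_add, Real.exp_le_exp]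
  -- The tangent to `log` at `(exp t - 1) / t` has a slope that cancels the term `-p * t`, so the
  -- bound no longer depends on `p`.
  have h1 : Real.log ((1 + p * (Real.exp t - 1)) * (t / (Real.exp t - 1)))
      ≤ (1 + p * (Real.exp t - 1)) * (t / (Real.exp t - 1)) - 1 :=
    Real.log_le_sub_one_of_pos (by positivity)
  rw [Real.log_mul hz.ne' (by positivity), Real.log_div ht.ne' hE.ne'] at h1
  have h2 : (1 + p * (Real.exp t - 1)) * (t / (Real.exp t - 1))
      = t * (Real.exp t - 1)⁻¹ + p * t := by field_simp
  have h3 : Real.log (1 - Real.exp (-t)) = Real.log (Real.exp t - 1) - t := by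
    have : 1 - Real.exp (-t) = (Real.exp t - 1) / Real.exp t := by
      rw [Real.exp_neg]; field_simp
    rw [this, Real.log_div hE.ne' (by positivity), Real.log_exp]
  rw [ell, if_neg ht.ne', h3]
  linarith

/-! ### A lower bound for the Young transform of `ℓ` -/

/-- The Taylor expansion is `h / 3 - h ^ 3 / 45 + ⋯`; weakening `45` to `60` leaves room for the
remainder up to `h = 1`. After multiplication by `h * sinh h`, two differentiations reduce the claim
to a comparison of `sinh` and `x * cosh x`. -/
lemma langevin_le {h : ℝ} (hh : 0 < h) (hh1 : h ≤ 1) :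
    langevin h ≤ h / 3 - h ^ 3 / 60 := by
  have base : ∀ x : ℝ, 0 ≤ x → 3 * (x * Real.cosh x) ≤ Real.sinh x * (3 + x ^ 2) := by
    intro x hx
    rw [← sub_nonneg]
    refine nonneg_of_deriv_nonneg
      (f := fun x => Real.sinh x * (3 + x ^ 2) - 3 * (x * Real.cosh x))
      (f' := fun x => x * (x * Real.cosh x - Real.sinh x)) (by simp) (fun x => ?_)
      (fun x hx _ => mul_nonneg hx.le (sub_nonneg.2 (sinh_le_mul_cosh hx.le))) hx le_rfl
    refine HasDerivAt.congr_deriv (((Real.hasDerivAt_sinh x).mul (((hasDerivAt_id x).pow 2).const_add 3)).sub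
      (((hasDerivAt_id x).mul (Real.hasDerivAt_cosh x)).const_mul 3)) ?_
    simp; ring
  have step2 : ∀ x : ℝ, 0 ≤ x → x ≤ 1 →
      0 ≤ (x / 3 - x ^ 3 / 60) * Real.cosh x - (1 / 3 + x ^ 2 / 15) * Real.sinh x := by
    intro x hx hx1
    refine nonneg_of_deriv_nonneg (b := 1)
      (f := fun x => (x / 3 - x ^ 3 / 60) * Real.cosh x - (1 / 3 + x ^ 2 / 15) * Real.sinh x)
      (f' := fun x => (x / 5 - x ^ 3 / 60) * Real.sinh x - 7 / 60 * x ^ 2 * Real.cosh x)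
      (by simp) (fun x => ?_) (fun x hx hx1 => ?_) hx hx1
    · refine HasDerivAt.congr_deriv (((((hasDerivAt_id x).div_const 3).sub (((hasDerivAt_id x).pow 3).div_const 60)).mul
        (Real.hasDerivAt_cosh x)).sub
        (((((hasDerivAt_id x).pow 2).div_const 15).const_add (1 / 3)).mul
        (Real.hasDerivAt_sinh x))) ?_
      simp; ring
    · have hs := Real.sinh_pos_iff.2 hx
      have hb := base x hx.le
      have h2 : x ^ 2 ≤ 1 := by nlinarith
      have h3 : 0 ≤ x * Real.sinh x * (1 - x ^ 2) := by
        have : 0 ≤ 1 - x ^ 2 := by linarith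
        positivity
      have h4 := mul_le_mul_of_nonneg_left hb hx.le
      have h5 : 0 < x * Real.sinh x := by positivity
      nlinarith
  have step1 : 0 ≤ (h ^ 2 / 3 - h ^ 4 / 60 + 1) * Real.sinh h - h * Real.cosh h := by
    refine nonneg_of_deriv_nonneg (b := 1)
      (f := fun x => (x ^ 2 / 3 - x ^ 4 / 60 + 1) * Real.sinh x - x * Real.cosh x)
      (f' := fun x => x * ((x / 3 - x ^ 3 / 60) * Real.cosh x - (1 / 3 + x ^ 2 / 15) * Real.sinh x))
      (by simp) (fun x => ?_) (fun x hx hx1 => mul_nonneg hx.le (step2 x hx.le hx1.le)) hh.le hh1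
    refine HasDerivAt.congr_deriv (((((((hasDerivAt_id x).pow 2).div_const 3).sub
        (((hasDerivAt_id x).pow 4).div_const 60)).add_const 1).mul
        (Real.hasDerivAt_sinh x)).sub
        ((hasDerivAt_id x).mul (Real.hasDerivAt_cosh x))) ?_
    simp; ring
  have hs := Real.sinh_pos_iff.2 hh
  rw [langevin, div_sub_div _ _ hs.ne' hh.ne', div_le_iff₀ (by positivity)]
  linarith

lemma logSinhc_le {h : ℝ} (hh : 0 ≤ h) (hh1 : h ≤ 1) :
    logSinhc h ≤ h ^ 2 / 6 - h ^ 4 / 240 := by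
  have hd : ∀ x : ℝ, 0 < x → HasDerivAt (fun x => x ^ 2 / 6 - x ^ 4 / 240 - logSinhc x)
      (x / 3 - x ^ 3 / 60 - langevin x) x := by
    intro x hx
    refine ((((hasDerivAt_id x).pow 2).div_const 6).sub
      (((hasDerivAt_id x).pow 4).div_const 240)).sub (hasDerivAt_logSinhc hx)
      |>.congr_deriv ?_
    simp; ring
  have hm := monotoneOn_of_deriv_nonneg (convex_Icc 0 1)
    (f := fun x => x ^ 2 / 6 - x ^ 4 / 240 - logSinhc x)
    (ContinuousOn.sub (by fun_prop) (continuousOn_logSinhc.mono Set.Icc_subset_Ici_self))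
    (fun x hx => by
      rw [interior_Icc] at hx
      exact (hd x hx.1).differentiableAt.differentiableWithinAt)
    (fun x hx => by
      rw [interior_Icc] at hx
      rw [(hd x hx.1).deriv]
      exact sub_nonneg.2 (langevin_le hx.1 hx.2.le)) ⟨le_rfl, zero_le_one⟩ ⟨hh, hh1⟩ hh
  simp only [logSinhc_zero] at hm
  norm_num at hm
  linarith

lemma ell_two_mul_le {h : ℝ} (hh : 0 < h) (hh1 : h ≤ 1) :
    ell (2 * h) ≤ h ^ 2 / 2 - h ^ 4 / 48 := by
  rw [ell_two_mul hh]
  have h1 := mul_le_mul_of_nonneg_left (langevin_le hh hh1) hh.le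
  have h2 := logSinhc_le hh.le hh1
  nlinarith

/-- Tailored to the choice `t = 4u`: multiplied by `u * (2 - u)`, the right side becomes `2u² + u⁴ /
3`, which is what `ell_two_mul_le` with `h = 2u` leaves for `u * t - ell t`. -/
lemma neg_log_one_sub_le {u : ℝ} (hu : 0 ≤ u) (hu1 : u ≤ 2 / 5) :
    -Real.log (1 - u) ≤ (2 * u + u ^ 3 / 3) / (2 - u) := by
  have hd : ∀ x ∈ Set.Icc (0 : ℝ) (2 / 5), HasDerivAt
      (fun x => (2 * x + x ^ 3 / 3) / (2 - x) + Real.log (1 - x))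
      (((2 + x ^ 2) * (2 - x) + (2 * x + x ^ 3 / 3)) / (2 - x) ^ 2 - 1 / (1 - x)) x := by
    rintro x ⟨hx0, hx1⟩
    have h1 : (2 - x) ≠ 0 := by linarith
    have h2 : (1 - x) ≠ 0 := by linarith
    refine (((((hasDerivAt_id x).const_mul 2).add (((hasDerivAt_id x).pow 3).div_const 3)).div
      ((hasDerivAt_id x).const_sub 2) h1).add (((hasDerivAt_id x).const_sub 1).log h2)).congr_deriv
      ?_
    simp; ring
  have hm := monotoneOn_of_deriv_nonneg (convex_Icc (0 : ℝ) (2 / 5))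
    (fun x hx => (hd x hx).continuousAt.continuousWithinAt)
    (fun x hx => (hd x (interior_subset hx)).differentiableAt.differentiableWithinAt)
    (fun x hx => by
      rw [(hd x (interior_subset hx)).deriv]
      obtain ⟨hx0, hx1⟩ := interior_subset hx
      have h1 : 0 < 2 - x := by linarith
      have h2 : 0 < 1 - x := by linarith
      rw [sub_nonneg, div_le_div_iff₀ h2 (by positivity)]
      have h3 : 0 ≤ x ^ 2 * (1 - 8 / 3 * x + 2 / 3 * x ^ 2) := by
        apply mul_nonneg (by positivity); nlinarith
      nlinarith) ⟨le_rfl, by norm_num⟩ ⟨hu, hu1⟩ hu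
  norm_num at hm
  linarith

/-- At `t = 1 / (1 - u)` one has `u * t - ell t = log t - r`, where `r` is the bracket here, while
the target is `(1 - t⁻²) * log t`; so the claim `t² * r ≤ log t` is what is needed. The threshold `5
/ 3` corresponds to `u = 2 / 5`. -/
lemma sq_mul_le_log {t : ℝ} (ht : 5 / 3 ≤ t) :
    t ^ 2 * (t * (Real.exp t - 1)⁻¹ + Real.log (1 - Real.exp (-t))) ≤ Real.log t := by
  obtain ⟨z, rfl⟩ : ∃ z, t = 5 / 3 + z := ⟨t - 5 / 3, by ring⟩
  have hz : 0 ≤ z := by linarith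
  set t := 5 / 3 + z with htz
  -- A polynomial minorant of `exp t`: `21 / 4` lies just below `exp (5 / 3)`, and the other factor
  -- truncates the series of `exp z`.
  set P : ℝ := 21 / 4 * (1 + z + z ^ 2 / 2 + z ^ 3 / 6) with hP
  have hE : P ≤ Real.exp t := by
    rw [htz, Real.exp_add]
    have h1 : (21 / 4 : ℝ) ≤ Real.exp (5 / 3) := by
      refine le_trans ?_ (Real.sum_le_exp_of_nonneg (by norm_num) 7)
      norm_num [Finset.sum_range_succ, Nat.factorial]
    have h2 : 1 + z + z ^ 2 / 2 + z ^ 3 / 6 ≤ Real.exp z := by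
      refine le_trans (le_of_eq ?_) (Real.sum_le_exp_of_nonneg hz 4)
      norm_num [Finset.sum_range_succ, Nat.factorial]
    exact mul_le_mul h1 h2 (by positivity) (by positivity)
  have hP1 : 1 < P := by rw [hP]; nlinarith [pow_nonneg hz 2, pow_nonneg hz 3]
  set x := Real.exp (-t) with hx
  have hxP : x ≤ 1 / P := by
    rw [hx, Real.exp_neg, one_div]
    exact inv_anti₀ (by positivity) hE
  have hx0 : 0 < x := Real.exp_pos _
  have hP0 : 0 < P := by linarith
  have hx1 : x < 1 := hxP.trans_lt (by rw [div_lt_one hP0]; exact hP1)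
  have hlog : Real.log (1 - x) ≤ -x - x ^ 2 / 2 := by
    have h1 := sum_le_hasSum (Finset.range 2) (fun i _ => by positivity)
      (Real.hasSum_pow_div_log_of_abs_lt_one (abs_lt.2 ⟨by linarith, hx1⟩))
    norm_num [Finset.sum_range_succ] at h1
    linarith
  have hinv : t * (Real.exp t - 1)⁻¹ = t * x / (1 - x) := by
    rw [hx, Real.exp_neg]
    have : Real.exp t - 1 ≠ 0 := by linarith
    field_simp
  have hr : t * (Real.exp t - 1)⁻¹ + Real.log (1 - x) ≤
      t * (1 / P) / (1 - 1 / P) - 1 / P - (1 / P) ^ 2 / 2 := by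
    rw [hinv]
    set q := 1 / P with hq
    have hq1 : q < 1 := by rw [hq, div_lt_one hP0]; exact hP1
    have key : t * q / (1 - q) - t * x / (1 - x) = t * (q - x) / ((1 - q) * (1 - x)) := by
      have : 1 - q ≠ 0 := by linarith
      have : 1 - x ≠ 0 := by linarith
      field_simp; ring
    have : t * (q - x) ≤ t * (q - x) / ((1 - q) * (1 - x)) := by
      rw [le_div_iff₀ (mul_pos (by linarith) (by linarith))]
      refine mul_le_of_le_one_right (mul_nonneg (by linarith) (by linarith)) ?_
      nlinarith
    have hq2 : q ≤ 1 / 2 := by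
      rw [hq, div_le_div_iff₀ hP0 two_pos, hP]
      nlinarith [pow_nonneg hz 2, pow_nonneg hz 3]
    have : 0 ≤ (q - x) * (t - 1 - (q + x) / 2) := mul_nonneg (by linarith) (by linarith)
    nlinarith
  -- Two terms of `log t = 2 artanh y` with `y = (t - 1) / (t + 1)`.
  have hlt : 2 * ((2 + 3 * z) / (8 + 3 * z) + ((2 + 3 * z) / (8 + 3 * z)) ^ 3 / 3)
      ≤ Real.log t := by
    have hy : (2 + 3 * z) / (8 + 3 * z) < 1 := by
      rw [div_lt_one (by positivity)]; linarith
    have := Real.sum_range_le_log_div (by positivity) hy 2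
    have e : (1 + (2 + 3 * z) / (8 + 3 * z)) / (1 - (2 + 3 * z) / (8 + 3 * z)) = t := by
      rw [htz]
      have : (8 + 3 * z) - (2 + 3 * z) ≠ 0 := by ring_nf; norm_num
      field_simp
      ring
    rw [e] at this
    norm_num [Finset.sum_range_succ] at this
    linarith
  refine (mul_le_mul_of_nonneg_left hr (by positivity)).trans (le_trans ?_ hlt)
  rw [← sub_nonneg]
  have hne : P - 1 ≠ 0 := by linarith
  have e : 2 * ((2 + 3 * z) / (8 + 3 * z) + ((2 + 3 * z) / (8 + 3 * z)) ^ 3 / 3)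
      - t ^ 2 * (t * (1 / P) / (1 - 1 / P) - 1 / P - (1 / P) ^ 2 / 2)
      = ((6 * (2 + 3 * z) * (8 + 3 * z) ^ 2 + 2 * (2 + 3 * z) ^ 3) * (2 * P ^ 2 * (P - 1))
        - 3 * (8 + 3 * z) ^ 3 * t ^ 2 * (2 * t * P ^ 2 - 2 * P * (P - 1) - (P - 1)))
        / (6 * (8 + 3 * z) ^ 3 * P ^ 2 * (P - 1)) := by
    have : 1 - 1 / P = (P - 1) / P := by field_simp
    rw [this]
    field_simp
    ring
  rw [e]
  have hP2 : 0 < P - 1 := by linarith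
  refine div_nonneg ?_ (by positivity)
  rw [htz, hP]
  -- Expanded in powers of `z ≥ 0`, the numerator has no negative coefficient.
  ring_nf
  positivity

lemma le_ellStar (u : ℝ) {t : ℝ} (ht : 0 < t) : ((u * t - ell t : ℝ) : EReal) ≤ ellStar u :=
  le_iSup (fun t : Set.Ioi (0 : ℝ) => ((u * t - ell t : ℝ) : EReal)) ⟨t, ht⟩

lemma ellStar_one : ellStar 1 = ⊤ := by
  rw [EReal.eq_top_iff_forall_lt]
  intro y
  -- Since `t - ell t = log t + 1 - r` with `r ≤ log t / 2`, it is enough that `log t / 2 ≥ y + 1`.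
  set t := max (5 / 3) (Real.exp (2 * (y + 1))) with ht
  have ht1 : 5 / 3 ≤ t := le_max_left _ _
  have ht0 : 0 < t := by linarith
  refine lt_of_lt_of_le ?_ (le_ellStar 1 ht0)
  rw [EReal.coe_lt_coe_iff]
  have h1 := sq_mul_le_log ht1
  have h2 : 2 * (y + 1) ≤ Real.log t := by
    rw [Real.le_log_iff_exp_le ht0]; exact le_max_right _ _
  have h3 : 0 ≤ Real.log t := Real.log_nonneg (by linarith)
  set r := t * (Real.exp t - 1)⁻¹ + Real.log (1 - Real.exp (-t)) with hr
  have h4 : r ≤ Real.log t / 2 := by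
    by_contra! hcon
    have : t ^ 2 * (Real.log t / 2) < t ^ 2 * r :=
      mul_lt_mul_of_pos_left hcon (by positivity)
    have h6 : 2 ≤ t ^ 2 := by nlinarith
    nlinarith [mul_le_mul_of_nonneg_right h6 h3]
  have h5 : ell t = t - Real.log t - 1 + r := by
    rw [ell, if_neg ht0.ne', hr]; ring
  rw [h5]; linarith

lemma le_ellStar_of_lt_one {u : ℝ} (hu : 0 ≤ u) (hu1 : u < 1) :
    (((2 * u - u ^ 2) * -Real.log (1 - u) : ℝ) : EReal) ≤ ellStar u := by
  rcases hu.eq_or_lt with rfl | hu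
  -- At `u = 0` the value `0` is only approached as `t → 0`, so any `z < 0` is beaten by a small
  -- enough `t`.
  · by_contra! hcon
    obtain ⟨z, hz0, hz⟩ := EReal.lt_iff_exists_real_btwn.1 hcon
    refine absurd hz0 (not_lt.2 ?_)
    norm_num at hz
    have hz' : 0 < min 1 (-z) := lt_min one_pos (by linarith)
    refine le_trans ?_ (le_ellStar 0 (mul_pos two_pos hz'))
    rw [EReal.coe_le_coe_iff]
    have h1 := ell_two_mul_le hz' (min_le_left _ _)
    have h2 := min_le_left 1 (-z)
    have h3 := min_le_right 1 (-z)
    nlinarith [pow_pos hz' 4]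
  rcases le_or_gt u (2 / 5) with h | h
  · refine le_trans ?_ (le_ellStar u (mul_pos two_pos (mul_pos two_pos hu)))
    rw [EReal.coe_le_coe_iff]
    have h1 := ell_two_mul_le (mul_pos two_pos hu) (by linarith)
    have h2 := neg_log_one_sub_le hu.le h
    rw [le_div_iff₀ (by linarith)] at h2
    have h3 := mul_le_mul_of_nonneg_left h2 hu.le
    nlinarith
  · have hv : 0 < 1 - u := by linarith
    refine le_trans ?_ (le_ellStar u (inv_pos.2 hv))
    rw [EReal.coe_le_coe_iff]
    have ht : 5 / 3 ≤ (1 - u)⁻¹ := by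
      rw [le_inv_comm₀ (by norm_num) hv]; norm_num; linarith
    have h1 := sq_mul_le_log ht
    rw [ell, if_neg (by positivity)]
    set r := (1 - u)⁻¹ * (Real.exp (1 - u)⁻¹ - 1)⁻¹ + Real.log (1 - Real.exp (-(1 - u)⁻¹)) with hr
    rw [Real.log_inv] at *
    have h2 := mul_le_mul_of_nonneg_left h1 (sq_nonneg (1 - u))
    rw [← mul_assoc, ← mul_pow, mul_inv_cancel₀ hv.ne', one_pow, one_mul] at h2
    have h3 : u * (1 - u)⁻¹ = (1 - u)⁻¹ - 1 := by field_simp; ring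
    rw [h3]
    have h4 : (1 - u)⁻¹ - -Real.log (1 - u) - 1 + (1 - u)⁻¹ * (Real.exp (1 - u)⁻¹ - 1)⁻¹
      + Real.log (1 - Real.exp (-(1 - u)⁻¹)) = (1 - u)⁻¹ - -Real.log (1 - u) - 1 + r := by
      rw [hr]; ring
    rw [h4]
    nlinarith

lemma exp_neg_ellStar_le {u c : ℝ} (hu : 0 ≤ u) (hu1 : u ≤ 1) (hc : 0 < c) :
    EReal.exp (-((c : EReal) * ellStar u))
      ≤ ENNReal.ofReal ((1 - u) ^ (c * (2 * u - u ^ 2))) := by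
  rcases hu1.eq_or_lt with rfl | hu1
  · rw [ellStar_one, EReal.coe_mul_top_of_pos hc]
    simp
  · rw [Real.rpow_def_of_pos (by linarith), ← EReal.exp_coe, EReal.exp_le_exp_iff,
      EReal.neg_le, ← EReal.coe_neg]
    have h := mul_le_mul_of_nonneg_left (le_ellStar_of_lt_one hu hu1)
      (EReal.coe_nonneg.2 hc.le)
    refine le_trans (le_of_eq ?_) h
    rw [← EReal.coe_mul]
    congr 1
    ring

/-- Chernoff's bound, with the rate expressed through `ellStar`. -/
lemma measure_lt_le_exp_neg_ellStar {Ω : Type*} [MeasurableSpace Ω] {μ : Measure Ω}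
    [IsProbabilityMeasure μ] {Z : Ω → ℝ} {d V : ℝ} (hd : 0 < d) (hV : 0 < V)
    (hint : ∀ s : ℝ, 0 ≤ s → Integrable (fun ω => Real.exp (s * Z ω)) μ)
    (hmgf : ∀ s : ℝ, 0 ≤ s →
      ∫ ω, Real.exp (s * Z ω) ∂μ ≤ Real.exp (d ^ 2 / V * ell (V * s / d))) (x : ℝ) :
    μ {ω | x < Z ω} ≤ EReal.exp (-(((d ^ 2 / V : ℝ) : EReal) * ellStar (x / d))) := by
  have hc : 0 < d ^ 2 / V := by positivity
  -- Isolating `ellStar` on the smaller side reduces the claim to one inequality for each `t` in the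
  -- supremum.
  rw [← ENNReal.log_le_log_iff, EReal.log_exp, EReal.le_neg, mul_comm,
    ← EReal.le_div_iff_mul_le (by exact_mod_cast hc) (EReal.coe_ne_top _)]
  refine iSup_le fun ⟨t, ht⟩ => ?_
  rw [EReal.le_div_iff_mul_le (by exact_mod_cast hc) (EReal.coe_ne_top _), EReal.le_neg,
    ← EReal.coe_mul, ← EReal.coe_neg, ← EReal.log_exp (((_ : ℝ) : EReal)),
    ENNReal.log_le_log_iff, EReal.exp_coe]
  have ht : 0 < t := ht
  -- This `s` gives `V * s / d = t` and `s * x = d ^ 2 / V * (x / d * t)`.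
  set s := t * d / V with hs
  have hs0 : 0 ≤ s := by positivity
  have h1 := measure_ge_le_exp_mul_mgf x hs0 (hint s hs0)
  have h2 : μ {ω | x < Z ω} ≤ μ {ω | x ≤ Z ω} := measure_mono fun ω (h : x < Z ω) => h.le
  refine h2.trans ?_
  rw [← ENNReal.ofReal_toReal (measure_ne_top μ {ω | x ≤ Z ω})]
  refine ENNReal.ofReal_le_ofReal (h1.trans ?_)
  refine (mul_le_mul_of_nonneg_left (hmgf s hs0) (Real.exp_pos _).le).trans (le_of_eq ?_)
  rw [← Real.exp_add]
  congr 1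
  have h3 : V * s / d = t := by rw [hs]; field_simp
  rw [h3, hs]
  field_simp
  ring

/-! ### Hoeffding's lemma with the function `ℓ` -/

section Hoeffding

variable {E : Type*} [MeasurableSpace E] {ν : Measure E} [IsProbabilityMeasure ν]

/-- Taking `a` to be the essential infimum gives an interval of length `Δ`, where centring at a
typical point would give `2Δ`. -/
lemma exists_interval_of_ae_abs_sub_le {φ : E → ℝ} {Δ : ℝ}
    (h : ∀ᵐ y ∂ν, ∀ᵐ y' ∂ν, |φ y - φ y'| ≤ Δ) :
    ∃ a, ∀ᵐ y ∂ν, a ≤ φ y ∧ φ y ≤ a + Δ := by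
  obtain ⟨y₀, hy₀⟩ := h.exists
  have hbelow : Filter.IsBoundedUnder (· ≥ ·) (ae ν) φ :=
    ⟨φ y₀ - Δ, by
      rw [Filter.eventually_map]
      filter_upwards [hy₀] with y hy
      linarith [(abs_le.1 hy).2]⟩
  have habove : Filter.IsBoundedUnder (· ≤ ·) (ae ν) φ :=
    ⟨φ y₀ + Δ, by
      rw [Filter.eventually_map]
      filter_upwards [hy₀] with y hy
      linarith [(abs_le.1 hy).1]⟩
  refine ⟨essInf φ ν, ?_⟩
  filter_upwards [ae_essInf_le hbelow, h] with y hy1 hy2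
  refine ⟨hy1, ?_⟩
  have : φ y - Δ ≤ essInf φ ν := by
    refine le_essInf_of_ae_le _ ?_ habove.isCoboundedUnder_ge
    filter_upwards [hy2] with y' hy'
    linarith [(abs_le.1 hy').2]
  linarith

lemma integrable_of_ae_abs_sub_le {φ : E → ℝ} (hφ : Measurable φ) {Δ : ℝ}
    (h : ∀ᵐ y ∂ν, ∀ᵐ y' ∂ν, |φ y - φ y'| ≤ Δ) : Integrable φ ν := by
  obtain ⟨a, ha⟩ := exists_interval_of_ae_abs_sub_le h
  refine Integrable.of_bound hφ.aestronglyMeasurable (|a| + |a + Δ|) ?_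
  filter_upwards [ha] with y hy
  rw [Real.norm_eq_abs]
  exact (abs_le_max_abs_abs hy.1 hy.2).trans
    (max_le (le_add_of_nonneg_right (abs_nonneg _)) (le_add_of_nonneg_left (abs_nonneg _)))

lemma ae_abs_sub_integral_le {φ : E → ℝ} (hφ : Measurable φ) {Δ : ℝ}
    (h : ∀ᵐ y ∂ν, ∀ᵐ y' ∂ν, |φ y - φ y'| ≤ Δ) : ∀ᵐ y ∂ν, |φ y - ∫ z, φ z ∂ν| ≤ Δ := by
  have hint := integrable_of_ae_abs_sub_le hφ h
  obtain ⟨a, ha⟩ := exists_interval_of_ae_abs_sub_le h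
  have h1 : a ≤ ∫ z, φ z ∂ν := by
    simpa using integral_mono_ae (integrable_const a) hint (ha.mono fun y hy => hy.1)
  have h2 : ∫ z, φ z ∂ν ≤ a + Δ := by
    simpa using integral_mono_ae hint (integrable_const (a + Δ)) (ha.mono fun y hy => hy.2)
  filter_upwards [ha] with y hy
  rw [abs_le]
  constructor <;> linarith [hy.1, hy.2]

/-- The exponential lies below its chord over `[a, a + Δ]`. The chord is affine, so its mean depends
only on the mean of `φ`, and equals the transform of a centered Bernoulli variable with `p = (e - a)
/ Δ`, scaled by `Δ`. -/
lemma lintegral_exp_le_ell {φ : E → ℝ} (hφ : Measurable φ) {Δ : ℝ} (hΔ : 0 < Δ)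
    (h : ∀ᵐ y ∂ν, ∀ᵐ y' ∂ν, |φ y - φ y'| ≤ Δ) {s : ℝ} (hs : 0 ≤ s) :
    ∫⁻ y, ENNReal.ofReal (Real.exp (s * (φ y - ∫ z, φ z ∂ν))) ∂ν
      ≤ ENNReal.ofReal (Real.exp (ell (s * Δ))) := by
  have hint := integrable_of_ae_abs_sub_le hφ h
  obtain ⟨a, ha⟩ := exists_interval_of_ae_abs_sub_le h
  set e := ∫ z, φ z ∂ν with he
  have h1 : a ≤ e := by
    simpa using integral_mono_ae (integrable_const a) hint (ha.mono fun y hy => hy.1)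
  set p := (e - a) / Δ with hp
  have hp0 : 0 ≤ p := div_nonneg (by linarith) hΔ.le
  have hea : e - a = p * Δ := by rw [hp]; field_simp
  set g : E → ℝ := fun y => Real.exp (s * (a - e)) *
    (1 + (φ y - a) / Δ * (Real.exp (s * Δ) - 1)) with hg
  have hconv : ∀ᵐ y ∂ν, Real.exp (s * (φ y - e)) ≤ g y := by
    filter_upwards [ha] with y hy
    set q := (φ y - a) / Δ with hq
    have hq0 : 0 ≤ q := div_nonneg (by linarith [hy.1]) hΔ.le
    have hq1 : q ≤ 1 := by rw [hq, div_le_one hΔ]; linarith [hy.2]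
    have hqa : φ y - a = q * Δ := by rw [hq]; field_simp
    have := convexOn_exp.2 (Set.mem_univ 0) (Set.mem_univ (s * Δ))
      (sub_nonneg.2 hq1) hq0 (by ring)
    simp only [smul_eq_mul, mul_zero, zero_add, Real.exp_zero, mul_one] at this
    have e1 : s * (φ y - e) = s * (a - e) + q * (s * Δ) := by linear_combination s * hqa
    rw [e1, Real.exp_add, hg]
    refine mul_le_mul_of_nonneg_left ?_ (Real.exp_pos _).le
    linarith
  have hgint : Integrable g ν :=
    ((integrable_const (1 : ℝ)).add ((((hint.sub (integrable_const a)).div_const Δ)).mul_const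
      (Real.exp (s * Δ) - 1))).const_mul _
  have hgval : ∫ y, g y ∂ν = Real.exp (-(p * (s * Δ))) * (1 + p * (Real.exp (s * Δ) - 1)) := by
    have i1 : Integrable (fun y => (φ y - a) / Δ * (Real.exp (s * Δ) - 1)) ν :=
      ((hint.sub (integrable_const a)).div_const Δ).mul_const _
    have i2 : ∫ y, (φ y - a) / Δ ∂ν = p := by
      rw [integral_div, integral_sub hint (integrable_const a)]
      simp [hp, he]
    rw [hg, integral_const_mul, integral_add (integrable_const _) i1, integral_mul_const, i2]
    have : s * (a - e) = -(p * (s * Δ)) := by linear_combination -s * hea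
    simp [this]
  calc ∫⁻ y, ENNReal.ofReal (Real.exp (s * (φ y - e))) ∂ν
      ≤ ∫⁻ y, ENNReal.ofReal (g y) ∂ν :=
        lintegral_mono_ae (hconv.mono fun y hy => ENNReal.ofReal_le_ofReal hy)
    _ = ENNReal.ofReal (∫ y, g y ∂ν) :=
        (ofReal_integral_eq_lintegral_ofReal hgint
          (hconv.mono fun y hy => (Real.exp_pos _).le.trans hy)).symm
    _ ≤ _ := by
        rw [hgval]
        exact ENNReal.ofReal_le_ofReal (bernoulli_mgf_le hp0 (by positivity))

end Hoeffding

/-! ### The induction along the chain -/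

lemma K_zero {ρ : ℝ} (h1 : ρ < 1) : K ρ 0 = 1 := by
  rw [K, zero_add, pow_one, div_self (by linarith)]

lemma K_succ {ρ : ℝ} (h1 : ρ < 1) (j : ℕ) : K ρ (j + 1) = 1 + ρ * K ρ j := by
  have : 1 - ρ ≠ 0 := by linarith
  rw [K, K]; field_simp; ring

lemma K_pos {ρ : ℝ} (h0 : 0 ≤ ρ) (h1 : ρ < 1) (j : ℕ) : 0 < K ρ j :=
  div_pos (sub_pos.2 (pow_lt_one₀ h0 h1 (by simp))) (by linarith)

section Chain

variable {𝒳 𝒴 : Type*}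

/-- One step of the chain, on the space of trajectories. -/
def extend {m : ℕ} (Φ : 𝒳 × 𝒴 → 𝒳) (z : (Fin (m + 1) → 𝒳) × 𝒴) : Fin (m + 2) → 𝒳 :=
  Fin.snoc (α := fun _ => 𝒳) z.1 (Φ (z.1 (Fin.last m), z.2))

lemma measurable_extend [MeasurableSpace 𝒳] [MeasurableSpace 𝒴] {m : ℕ} {Φ : 𝒳 × 𝒴 → 𝒳} (hΦ : Measurable Φ) :
    Measurable (extend (m := m) Φ) := by
  refine measurable_pi_lambda _ fun i => ?_
  refine Fin.lastCases ?_ (fun i => ?_) i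
  · simp only [extend, Fin.snoc_last]
    fun_prop
  · simp only [extend, Fin.snoc_castSucc]
    fun_prop

variable [MetricSpace 𝒳]

/-- `f` is separately Lipschitz, with constant `1` in all variables but the last one, where the
constant is `κ`. -/
def SepLipschitz {m : ℕ} (κ : ℝ) (f : (Fin (m + 1) → 𝒳) → ℝ) : Prop :=
  ∀ x x', |f x - f x'| ≤ ∑ i : Fin m, dist (x i.castSucc) (x' i.castSucc)
    + κ * dist (x (Fin.last m)) (x' (Fin.last m))

lemma SepLipschitz.continuous {m : ℕ} {κ : ℝ} (hκ : 0 ≤ κ) {f : (Fin (m + 1) → 𝒳) → ℝ}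
    (hf : SepLipschitz κ f) : Continuous f := by
  refine (LipschitzWith.of_dist_le_mul (K := ⟨m + κ, by positivity⟩) fun x x' => ?_).continuous
  rw [Real.dist_eq]
  refine (hf x x').trans ?_
  change _ ≤ (m + κ) * dist x x'
  have h1 : ∑ i : Fin m, dist (x i.castSucc) (x' i.castSucc) ≤ ∑ _i : Fin m, dist x x' :=
    Finset.sum_le_sum fun i _ => dist_le_pi_dist x x' _
  have h2 := mul_le_mul_of_nonneg_left (dist_le_pi_dist x x' (Fin.last m)) hκ
  simp only [Finset.sum_const, Finset.card_univ, Fintype.card_fin, nsmul_eq_mul] at h1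
  linarith

lemma SepLipschitz.abs_extend_sub_le {Φ : 𝒳 × 𝒴 → 𝒳} {m : ℕ} {κ : ℝ} {f : (Fin (m + 2) → 𝒳) → ℝ}
    (hf : SepLipschitz κ f) (x x' : Fin (m + 1) → 𝒳) (y y' : 𝒴) :
    |f (extend Φ (x, y)) - f (extend Φ (x', y'))| ≤ ∑ i, dist (x i) (x' i)
      + κ * dist (Φ (x (Fin.last m), y)) (Φ (x' (Fin.last m), y')) := by
  have := hf (extend Φ (x, y)) (extend Φ (x', y'))
  simpa only [extend, Fin.snoc_castSucc, Fin.snoc_last] using this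

variable [MeasurableSpace 𝒴] {ν : Measure 𝒴} {Φ : 𝒳 × 𝒴 → 𝒳} {ρ : ℝ}

lemma SepLipschitz.ae_abs_extend_sub_le {m : ℕ} {κ : ℝ} (hκ : 0 ≤ κ)
    {f : (Fin (m + 2) → 𝒳) → ℝ} (hf : SepLipschitz κ f) {x : Fin (m + 1) → 𝒳} {b : ℝ}
    (hx : ∀ᵐ y ∂ν, ∀ᵐ y' ∂ν, dist (Φ (x (Fin.last m), y)) (Φ (x (Fin.last m), y')) ≤ b) :
    ∀ᵐ y ∂ν, ∀ᵐ y' ∂ν, |f (extend Φ (x, y)) - f (extend Φ (x, y'))| ≤ κ * b := by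
  filter_upwards [hx] with y hy
  filter_upwards [hy] with y' hy'
  refine (hf.abs_extend_sub_le x x y y').trans ?_
  simp only [dist_self, Finset.sum_const_zero, zero_add]
  exact mul_le_mul_of_nonneg_left hy' hκ

variable [SecondCountableTopology 𝒳] [MeasurableSpace 𝒳] [BorelSpace 𝒳]

lemma integrable_dist_of_contract (hΦ : Measurable Φ)
    (hc : ∀ x x', ∫⁻ y, edist (Φ (x, y)) (Φ (x', y)) ∂ν ≤ ENNReal.ofReal ρ * edist x x')
    (x x' : 𝒳) : Integrable (fun y => dist (Φ (x, y)) (Φ (x', y))) ν := by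
  refine ⟨(by fun_prop : Measurable _).aestronglyMeasurable, ?_⟩
  rw [hasFiniteIntegral_iff_norm]
  simp only [Real.norm_eq_abs, abs_dist, ← edist_dist]
  exact (hc x x').trans_lt (ENNReal.mul_lt_top ENNReal.ofReal_lt_top (edist_lt_top _ _))

lemma integral_dist_le_of_contract (hΦ : Measurable Φ) (hρ : 0 ≤ ρ)
    (hc : ∀ x x', ∫⁻ y, edist (Φ (x, y)) (Φ (x', y)) ∂ν ≤ ENNReal.ofReal ρ * edist x x')
    (x x' : 𝒳) : ∫ y, dist (Φ (x, y)) (Φ (x', y)) ∂ν ≤ ρ * dist x x' := by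
  rw [← ENNReal.ofReal_le_ofReal_iff (by positivity), ENNReal.ofReal_mul hρ, ← edist_dist,
    ofReal_integral_eq_lintegral_ofReal (integrable_dist_of_contract hΦ hc x x')
      (Filter.Eventually.of_forall fun _ => dist_nonneg)]
  simp only [← edist_dist]
  exact hc x x'

variable [IsProbabilityMeasure ν]

/-- The increment bound is known only for almost every past, but the averaged function must be
Lipschitz everywhere. One good past `x₀` suffices: the difference from any other past is dominated
by a distance integrable by contraction. -/
lemma SepLipschitz.integrable_extend {m : ℕ} {κ : ℝ} (hκ : 0 ≤ κ) (hΦ : Measurable Φ)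
    (hc : ∀ x x', ∫⁻ y, edist (Φ (x, y)) (Φ (x', y)) ∂ν ≤ ENNReal.ofReal ρ * edist x x')
    {f : (Fin (m + 2) → 𝒳) → ℝ} (hf : SepLipschitz κ f) {b : ℝ} (x₀ : Fin (m + 1) → 𝒳)
    (hx₀ : ∀ᵐ y ∂ν, ∀ᵐ y' ∂ν, dist (Φ (x₀ (Fin.last m), y)) (Φ (x₀ (Fin.last m), y')) ≤ b)
    (x : Fin (m + 1) → 𝒳) : Integrable (fun y => f (extend Φ (x, y))) ν := by
  have hfm : Measurable f := (hf.continuous hκ).measurable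
  have hm : ∀ x : Fin (m + 1) → 𝒳, Measurable (fun y => f (extend Φ (x, y))) := fun x =>
    hfm.comp ((measurable_extend hΦ).comp measurable_prodMk_left)
  have h0 := integrable_of_ae_abs_sub_le (hm x₀) (hf.ae_abs_extend_sub_le hκ hx₀)
  have h1 : Integrable (fun y => f (extend Φ (x, y)) - f (extend Φ (x₀, y))) ν := by
    refine Integrable.mono' ((integrable_const (∑ i, dist (x i) (x₀ i))).add
      ((integrable_dist_of_contract hΦ hc (x (Fin.last m)) (x₀ (Fin.last m))).const_mul κ))
      ((hm x).sub (hm x₀)).aestronglyMeasurable (Filter.Eventually.of_forall fun y => ?_)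
    exact hf.abs_extend_sub_le x x₀ y y
  refine (h1.add h0).congr (Filter.Eventually.of_forall fun y => ?_)
  simp

lemma SepLipschitz.integral_extend {m : ℕ} {κ : ℝ} (hκ : 0 ≤ κ) (hΦ : Measurable Φ)
    (hρ : 0 ≤ ρ)
    (hc : ∀ x x', ∫⁻ y, edist (Φ (x, y)) (Φ (x', y)) ∂ν ≤ ENNReal.ofReal ρ * edist x x')
    {f : (Fin (m + 2) → 𝒳) → ℝ} (hf : SepLipschitz κ f)
    (hint : ∀ x, Integrable (fun y => f (extend Φ (x, y))) ν) :
    SepLipschitz (1 + ρ * κ) (fun x => ∫ y, f (extend Φ (x, y)) ∂ν) := by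
  intro x x'
  have hd := integrable_dist_of_contract hΦ hc (x (Fin.last m)) (x' (Fin.last m))
  have hd' := integral_dist_le_of_contract hΦ hρ hc (x (Fin.last m)) (x' (Fin.last m))
  simp only
  rw [← integral_sub (hint x) (hint x')]
  calc |∫ y, (f (extend Φ (x, y)) - f (extend Φ (x', y))) ∂ν|
      ≤ ∫ y, |f (extend Φ (x, y)) - f (extend Φ (x', y))| ∂ν := abs_integral_le_integral_abs
    _ ≤ ∫ y, (∑ i, dist (x i) (x' i)
          + κ * dist (Φ (x (Fin.last m), y)) (Φ (x' (Fin.last m), y))) ∂ν :=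
        integral_mono ((hint x).sub (hint x')).abs
          ((integrable_const _).add (hd.const_mul κ)) fun y => hf.abs_extend_sub_le x x' y y
    _ = ∑ i, dist (x i) (x' i)
          + κ * ∫ y, dist (Φ (x (Fin.last m), y)) (Φ (x' (Fin.last m), y)) ∂ν := by
        rw [integral_add (integrable_const _) (hd.const_mul κ), integral_const_mul]
        simp
    _ ≤ ∑ i, dist (x i) (x' i) + κ * (ρ * dist (x (Fin.last m)) (x' (Fin.last m))) :=
        add_le_add le_rfl (mul_le_mul_of_nonneg_left hd' hκ)
    _ = _ := by rw [Fin.sum_univ_castSucc]; ring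

end Chain

/-- The bound on the Laplace transform, for the laws `P m` of the trajectories of length `m + 1`
of a contracting Markov chain whose increments are bounded by `b`. -/
theorem integrable_and_lintegral_exp_le {𝒳 𝒴 : Type*} [MetricSpace 𝒳]
    [SecondCountableTopology 𝒳] [MeasurableSpace 𝒳] [BorelSpace 𝒳] [MeasurableSpace 𝒴]
    (P : (m : ℕ) → Measure (Fin (m + 1) → 𝒳)) [∀ m, IsProbabilityMeasure (P m)]
    (ν : Measure 𝒴) [IsProbabilityMeasure ν] (Φ : ℕ → 𝒳 × 𝒴 → 𝒳) (hΦ : ∀ m, Measurable (Φ m))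
    (hP : ∀ m, P (m + 1) = ((P m).prod ν).map (extend (Φ m)))
    {ρ : ℝ} (hρ0 : 0 ≤ ρ) (hρ1 : ρ < 1)
    (hc : ∀ m x x', ∫⁻ y, edist (Φ m (x, y)) (Φ m (x', y)) ∂ν ≤ ENNReal.ofReal ρ * edist x x')
    (b : ℕ → ℝ) (N : ℕ) (hb : ∀ m ≤ N, 0 < b m)
    (hb0 : ∀ᵐ x ∂P 0, ∀ᵐ x' ∂P 0, dist (x 0) (x' 0) ≤ b 0)
    (hbs : ∀ m < N, ∀ᵐ x ∂P m, ∀ᵐ y ∂ν, ∀ᵐ y' ∂ν,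
      dist (Φ m (x (Fin.last m), y)) (Φ m (x (Fin.last m), y')) ≤ b (m + 1))
    (m : ℕ) (hm : m ≤ N) (j : ℕ) (f : (Fin (m + 1) → 𝒳) → ℝ) (hf : SepLipschitz (K ρ j) f) :
    Integrable f (P m) ∧ ∀ s : ℝ, 0 ≤ s →
      ∫⁻ x, ENNReal.ofReal (Real.exp (s * (f x - ∫ x', f x' ∂P m))) ∂P m
        ≤ ENNReal.ofReal
          (Real.exp (∑ k ∈ Finset.range (m + 1), ell (s * (K ρ (m - k + j) * b k)))) := by
  -- The index `j` counts the innovations already integrated out, hence the Lipschitz constant `K ρ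
  -- j` and the shift `m - k + j`.
  induction m generalizing j with
  | zero =>
    have hκ := K_pos hρ0 hρ1 j
    have hfm : Measurable f := (hf.continuous hκ.le).measurable
    have hosc : ∀ᵐ x ∂P 0, ∀ᵐ x' ∂P 0, |f x - f x'| ≤ K ρ j * b 0 := by
      filter_upwards [hb0] with x hx
      filter_upwards [hx] with x' hx'
      refine (hf x x').trans ?_
      simp only [Finset.univ_eq_empty, Finset.sum_empty, zero_add]
      exact mul_le_mul_of_nonneg_left hx' hκ.le
    refine ⟨integrable_of_ae_abs_sub_le hfm hosc, fun s hs => ?_⟩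
    simpa using lintegral_exp_le_ell hfm (mul_pos hκ (hb 0 hm)) hosc hs
  | succ m ih =>
    have hκ := K_pos hρ0 hρ1 j
    have hfm : Measurable f := (hf.continuous hκ.le).measurable
    have hem : Measurable (extend (m := m) (Φ m)) := measurable_extend (hΦ m)
    have hbm := hbs m hm
    obtain ⟨x₀, hx₀⟩ := hbm.exists
    have hint := hf.integrable_extend hκ.le (hΦ m) (hc m) x₀ hx₀
    set g : (Fin (m + 1) → 𝒳) → ℝ := fun x => ∫ y, f (extend (Φ m) (x, y)) ∂ν with hg
    have hgL : SepLipschitz (K ρ (j + 1)) g := by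
      rw [K_succ hρ1]
      exact hf.integral_extend hκ.le (hΦ m) hρ0 (hc m) hint
    have hgm : Measurable g := (hgL.continuous (K_pos hρ0 hρ1 _).le).measurable
    obtain ⟨hgi, hgexp⟩ := ih (Nat.le_of_succ_le hm) (j + 1) g hgL
    have hsm : ∀ x : Fin (m + 1) → 𝒳, Measurable (fun y => f (extend (Φ m) (x, y))) := fun x =>
      hfm.comp (hem.comp measurable_prodMk_left)
    -- For almost every past, `f` stays within `K ρ j * b (m + 1)` of its conditional mean `g`,
    -- which is integrable by induction.
    have hfi : Integrable (fun z => f (extend (Φ m) z)) ((P m).prod ν) := by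
      refine (integrable_prod_iff (hfm.comp hem).aestronglyMeasurable).2 ⟨Filter.Eventually.of_forall hint, ?_⟩
      refine Integrable.mono' (hgi.abs.add (integrable_const (K ρ j * b (m + 1))))
        (hfm.comp hem).norm.stronglyMeasurable.integral_prod_right.aestronglyMeasurable ?_
      filter_upwards [hbm] with x hx
      have h1 := ae_abs_sub_integral_le (hsm x) (hf.ae_abs_extend_sub_le hκ.le hx)
      rw [Real.norm_eq_abs, abs_of_nonneg (integral_nonneg fun y => norm_nonneg _)]
      have h2 := integral_mono_ae (hint x).norm
        (integrable_const (μ := ν) (|g x| + K ρ j * b (m + 1))) ?_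
      · simpa using h2
      · filter_upwards [h1] with y hy
        have := abs_sub_abs_le_abs_sub (f (extend (Φ m) (x, y))) (g x)
        simp only [Real.norm_eq_abs]
        linarith
    have hfi' : Integrable f (P (m + 1)) := by
      rw [hP m, integrable_map_measure hfm.aestronglyMeasurable hem.aemeasurable]
      exact hfi
    refine ⟨hfi', fun s hs => ?_⟩
    have hmean : ∫ x, f x ∂P (m + 1) = ∫ x, g x ∂P m := by
      rw [hP m, integral_map hem.aemeasurable hfm.aestronglyMeasurable, integral_prod _ hfi]
    rw [hmean]
    set c := ∫ x, g x ∂P m with hcdef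
    -- Split `f - c` as `(g - c) + (f - g)`: the first part depends on the past only. Lower
    -- integrals spare any prior integrability of the exponentials.
    have hsplit : ∫⁻ x, ENNReal.ofReal (Real.exp (s * (f x - c))) ∂P (m + 1)
        = ∫⁻ x, ENNReal.ofReal (Real.exp (s * (g x - c))) *
          (∫⁻ y, ENNReal.ofReal (Real.exp (s * (f (extend (Φ m) (x, y)) - g x))) ∂ν) ∂P m := by
      rw [hP m, lintegral_map (by fun_prop) hem, lintegral_prod _ (by fun_prop)]
      refine lintegral_congr fun x => ?_
      have := hsm x
      rw [← lintegral_const_mul _ (by fun_prop)]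
      refine lintegral_congr fun y => ?_
      rw [← ENNReal.ofReal_mul (Real.exp_pos _).le, ← Real.exp_add]
      congr 2
      ring
    rw [hsplit]
    calc _ ≤ ∫⁻ x, ENNReal.ofReal (Real.exp (s * (g x - c))) *
          ENNReal.ofReal (Real.exp (ell (s * (K ρ j * b (m + 1))))) ∂P m := by
          refine lintegral_mono_ae ?_
          filter_upwards [hbm] with x hx
          exact mul_le_mul_right (lintegral_exp_le_ell (hsm x) (mul_pos hκ (hb _ hm))
            (hf.ae_abs_extend_sub_le hκ.le hx) hs) _
      _ = (∫⁻ x, ENNReal.ofReal (Real.exp (s * (g x - c))) ∂P m) *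
          ENNReal.ofReal (Real.exp (ell (s * (K ρ j * b (m + 1))))) :=
          lintegral_mul_const _ (by fun_prop)
      _ ≤ ENNReal.ofReal (Real.exp (∑ k ∈ Finset.range (m + 1),
            ell (s * (K ρ (m - k + (j + 1)) * b k)))) *
          ENNReal.ofReal (Real.exp (ell (s * (K ρ j * b (m + 1))))) :=
          mul_le_mul_left (hgexp s hs) _
      _ = _ := by
          rw [← ENNReal.ofReal_mul (Real.exp_pos _).le, ← Real.exp_add,
            Finset.sum_range_succ _ (m + 1)]
          congr 3
          · refine Finset.sum_congr rfl fun k hk => ?_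
            rw [Finset.mem_range] at hk
            rw [show m - k + (j + 1) = m + 1 - k + j by omega]
          · simp

/-! ### Laws of the trajectories -/

section Independence

variable {Ω α β γ : Type*} [MeasurableSpace Ω] {μ : Measure Ω}
  [MeasurableSpace α] [MeasurableSpace β] [MeasurableSpace γ]

lemma indepFun_of_measurable_comap {G : Ω → α} {U : Ω → β} {V : Ω → γ}
    (h : IndepFun G V μ) (hU : Measurable[MeasurableSpace.comap G inferInstance] U) :
    IndepFun U V μ := by
  rw [IndepFun_iff_Indep] at *
  exact indep_of_indep_of_le_left h hU.comap_le

lemma ae_le_of_eLpNorm_top_le {Z : Ω → ℝ} {c : ℝ} (hc : 0 ≤ c)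
    (h : eLpNorm Z ∞ μ ≤ ENNReal.ofReal c) : ∀ᵐ ω ∂μ, Z ω ≤ c := by
  rw [eLpNorm_exponent_top] at h
  filter_upwards [ae_le_eLpNormEssSup (f := Z) (μ := μ)] with ω hω
  have h1 := hω.trans h
  rw [Real.enorm_eq_ofReal_abs, ENNReal.ofReal_le_ofReal_iff hc] at h1
  exact (le_abs_self _).trans h1

variable [IsProbabilityMeasure μ]

/-- The joint law of the triple is a product of three measures, and reassociating the product
regroups the variables. -/
lemma indepFun_prodMk_left {A : Ω → α} {B : Ω → β} {C : Ω → γ} (hA : Measurable A)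
    (hB : Measurable B) (hC : Measurable C) (h : IndepFun A (fun ω => (B ω, C ω)) μ)
    (hBC : IndepFun B C μ) : IndepFun (fun ω => (A ω, B ω)) C μ := by
  have hAB : IndepFun A B μ := h.comp measurable_id measurable_fst
  rw [indepFun_iff_map_prod_eq_prod_map_map (hA.prodMk hB).aemeasurable hC.aemeasurable]
  rw [indepFun_iff_map_prod_eq_prod_map_map hA.aemeasurable hB.aemeasurable] at hAB
  rw [indepFun_iff_map_prod_eq_prod_map_map hB.aemeasurable hC.aemeasurable] at hBC
  rw [indepFun_iff_map_prod_eq_prod_map_map hA.aemeasurable (hB.prodMk hC).aemeasurable,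
    hBC] at h
  have := Measure.isProbabilityMeasure_map (μ := μ) hA.aemeasurable
  have := Measure.isProbabilityMeasure_map (μ := μ) hB.aemeasurable
  have := Measure.isProbabilityMeasure_map (μ := μ) hC.aemeasurable
  rw [← MeasurableEquiv.prodAssoc.map_measurableEquiv_injective.eq_iff, hAB,
    Measure.prodAssoc_prod, ← h, Measure.map_map (MeasurableEquiv.measurable _) (by fun_prop)]
  rfl

lemma ae_ae_of_indepFun {U : Ω → α} {V : Ω → β} (hU : AEMeasurable U μ) (hV : AEMeasurable V μ)
    (h : IndepFun U V μ) {p : α × β → Prop} (hp : MeasurableSet {z | p z})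
    (hae : ∀ᵐ ω ∂μ, p (U ω, V ω)) : ∀ᵐ x ∂(μ.map U), ∀ᵐ y ∂(μ.map V), p (x, y) := by
  rw [indepFun_iff_map_prod_eq_prod_map_map hU hV] at h
  have := Measure.isProbabilityMeasure_map (μ := μ) hU
  have := Measure.isProbabilityMeasure_map (μ := μ) hV
  refine Measure.ae_ae_of_ae_prod ?_
  rw [← h]
  exact (ae_map_iff (hU.prodMk hV) hp).2 hae

end Independence

lemma measurable_state {Ω 𝒳 𝒴 : Type*} [MeasurableSpace 𝒳] [MeasurableSpace 𝒴]
    {mΩ : MeasurableSpace Ω} {X : ℕ → Ω → 𝒳} {ε : ℕ → Ω → 𝒴} {F : ℕ → 𝒳 × 𝒴 → 𝒳}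
    (hF : ∀ t, 2 ≤ t → Measurable (F t))
    (hX : ∀ t, 2 ≤ t → ∀ ω, X t ω = F t (X (t - 1) ω, ε t ω)) (hX1 : Measurable (X 1))
    {m : ℕ} (hε : ∀ t, 2 ≤ t → t ≤ m + 1 → Measurable (ε t)) {k : ℕ} (hk : k ≤ m) :
    Measurable (X (k + 1)) := by
  induction k with
  | zero => exact hX1
  | succ k ih =>
    have : X (k + 2) = fun ω => F (k + 2) (X (k + 1) ω, ε (k + 2) ω) :=
      funext fun ω => hX (k + 2) (by omega) ω
    rw [this]
    exact (hF _ (by omega)).comp ((ih (by omega)).prodMk (hε _ (by omega) (by omega)))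

/-- The σ-algebra on `Ω` is free, so this also expresses adaptedness: it is applied with the
σ-algebra generated by the initial state and the innovations. -/
lemma measurable_path {Ω 𝒳 𝒴 : Type*} [MeasurableSpace 𝒳] [MeasurableSpace 𝒴]
    {mΩ : MeasurableSpace Ω} {X : ℕ → Ω → 𝒳} {ε : ℕ → Ω → 𝒴} {F : ℕ → 𝒳 × 𝒴 → 𝒳}
    (hF : ∀ t, 2 ≤ t → Measurable (F t))
    (hX : ∀ t, 2 ≤ t → ∀ ω, X t ω = F t (X (t - 1) ω, ε t ω)) (hX1 : Measurable (X 1))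
    {m : ℕ} (hε : ∀ t, 2 ≤ t → t ≤ m + 1 → Measurable (ε t)) :
    Measurable (path (m + 1) X) :=
  measurable_pi_lambda _ fun i =>
    measurable_state hF hX hX1 hε (Nat.lt_succ_iff.1 i.isLt)

lemma path_succ {Ω 𝒳 𝒴 : Type*} {X : ℕ → Ω → 𝒳} {ε : ℕ → Ω → 𝒴} {F : ℕ → 𝒳 × 𝒴 → 𝒳}
    (hX : ∀ t, 2 ≤ t → ∀ ω, X t ω = F t (X (t - 1) ω, ε t ω)) (m : ℕ) (ω : Ω) :
    path (m + 2) X ω = extend (F (m + 2)) (path (m + 1) X ω, ε (m + 2) ω) := by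
  funext i
  refine Fin.lastCases ?_ (fun i => ?_) i
  · simp only [extend, Fin.snoc_last, path, Fin.val_last]
    exact hX (m + 2) (by omega) ω
  · simp only [extend, Fin.snoc_castSucc, path, Fin.val_castSucc]

lemma indepFun_path_innovation {Ω 𝒳 𝒴 : Type*} [MeasurableSpace 𝒳] [MeasurableSpace 𝒴]
    [MeasurableSpace Ω] {μ : Measure Ω} [IsProbabilityMeasure μ]
    {X : ℕ → Ω → 𝒳} {ε : ℕ → Ω → 𝒴} {F : ℕ → 𝒳 × 𝒴 → 𝒳}
    (hF : ∀ t, 2 ≤ t → Measurable (F t))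
    (hX : ∀ t, 2 ≤ t → ∀ ω, X t ω = F t (X (t - 1) ω, ε t ω)) (hX1 : Measurable (X 1))
    (hε : ∀ t, 2 ≤ t → Measurable (ε t))
    (hε_indep : iIndepFun (fun t : Set.Ici (2 : ℕ) => ε t) μ)
    (hX1ε : IndepFun (X 1) (innov ε) μ) (m : ℕ) :
    IndepFun (path (m + 1) X) (ε (m + 2)) μ := by
  let S : Finset (Set.Ici (2 : ℕ)) := (Finset.range (m + 2)).subtype (· ∈ Set.Ici 2)
  let last : Set.Ici (2 : ℕ) := ⟨m + 2, by simp⟩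
  let B : Ω → S → 𝒴 := fun ω i => ε i ω
  have hεS : ∀ i : Set.Ici (2 : ℕ), Measurable (ε i) := fun i => hε i i.2
  have hB : Measurable B := measurable_pi_lambda _ fun i => hεS i
  have hdisj : Disjoint S {last} := by
    rw [Finset.disjoint_singleton_right, Finset.mem_subtype]
    simp [last]
  have h1 : IndepFun B (ε (m + 2)) μ :=
    (hε_indep.indepFun_finset S {last} hdisj hεS).comp measurable_id
      (measurable_pi_apply (⟨last, Finset.mem_singleton_self last⟩ : ({last} : Finset _)))
  have h2 : IndepFun (X 1) (fun ω => (B ω, ε (m + 2) ω)) μ :=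
    hX1ε.comp (ψ := fun e : Set.Ici (2 : ℕ) → 𝒴 => ((fun i : S => e i), e last))
      measurable_id (by fun_prop)
  have h3 := indepFun_prodMk_left hX1 hB (hε _ (by omega)) h2 h1
  refine indepFun_of_measurable_comap h3 ?_
  have hcomap : Measurable[MeasurableSpace.comap (fun ω => (X 1 ω, B ω)) inferInstance]
    (fun ω => (X 1 ω, B ω)) := comap_measurable _
  refine measurable_path hF hX (measurable_fst.comp hcomap) fun t ht htm => ?_
  have ht' : (⟨t, ht⟩ : Set.Ici (2 : ℕ)) ∈ S := by
    rw [Finset.mem_subtype, Finset.mem_range]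
    exact Nat.lt_succ_of_le htm
  exact (measurable_pi_apply (⟨⟨t, ht⟩, ht'⟩ : S)).comp (measurable_snd.comp hcomap)

lemma ae_dist_transition_le {Ω 𝒳 𝒴 : Type*} [MetricSpace 𝒳] [SecondCountableTopology 𝒳]
    [MeasurableSpace 𝒳] [BorelSpace 𝒳] [MeasurableSpace 𝒴]
    [MeasurableSpace Ω] {μ : Measure Ω} [IsProbabilityMeasure μ]
    {X : ℕ → Ω → 𝒳} {ε ε' : ℕ → Ω → 𝒴} {F : ℕ → 𝒳 × 𝒴 → 𝒳} {X1' : Ω → 𝒳}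
    (hF : ∀ t, 2 ≤ t → Measurable (F t))
    (hX : ∀ t, 2 ≤ t → ∀ ω, X t ω = F t (X (t - 1) ω, ε t ω)) (hX1 : Measurable (X 1))
    (hε : ∀ t, 2 ≤ t → Measurable (ε t))
    (hε_indep : iIndepFun (fun t : Set.Ici (2 : ℕ) => ε t) μ)
    (hX1ε : IndepFun (X 1) (innov ε) μ)
    (hcopy_ident : IdentDistrib (fun ω => (X1' ω, innov ε' ω))
      (fun ω => (X 1 ω, innov ε ω)) μ μ)
    (hcopy_indep : IndepFun (fun ω => (X1' ω, innov ε' ω))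
      (fun ω => (X 1 ω, innov ε ω)) μ) (m : ℕ) {c : ℝ}
    (h : ∀ᵐ ω ∂μ, dist (F (m + 2) (X (m + 1) ω, ε (m + 2) ω))
      (F (m + 2) (X (m + 1) ω, ε' (m + 2) ω)) ≤ c) :
    ∀ᵐ x ∂(μ.map (path (m + 1) X)), ∀ᵐ y ∂(μ.map (ε (m + 2))), ∀ᵐ y' ∂(μ.map (ε (m + 2))),
      dist (F (m + 2) (x (Fin.last m), y)) (F (m + 2) (x (Fin.last m), y')) ≤ c := by
  let last : Set.Ici (2 : ℕ) := ⟨m + 2, by simp⟩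
  have hFm := hF (m + 2) (by omega)
  have hpath : Measurable (path (m + 1) X) := measurable_path hF hX hX1 fun t ht _ => hε t ht
  have hεm := hε (m + 2) (by omega)
  have hcoord : Measurable (fun z : 𝒳 × (Set.Ici (2 : ℕ) → 𝒴) => z.2 last) := by fun_prop
  have hident : IdentDistrib (ε' (m + 2)) (ε (m + 2)) μ μ := hcopy_ident.comp hcoord
  have h1 : IndepFun (fun ω => (X 1 ω, innov ε ω)) (ε' (m + 2)) μ :=
    hcopy_indep.symm.comp measurable_id hcoord
  have hG : Measurable[MeasurableSpace.comap (fun ω => (X 1 ω, innov ε ω)) inferInstance]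
    (fun ω => (X 1 ω, innov ε ω)) := comap_measurable _
  have hGε : ∀ t, 2 ≤ t →
      Measurable[MeasurableSpace.comap (fun ω => (X 1 ω, innov ε ω)) inferInstance] (ε t) :=
    fun t ht => (measurable_pi_apply (⟨t, ht⟩ : Set.Ici (2 : ℕ))).comp (measurable_snd.comp hG)
  -- The pair is measurable for the original sequence, hence independent of the copy; with the
  -- independence of past and innovation, the triple has a product law.
  have h2 : IndepFun (fun ω => (path (m + 1) X ω, ε (m + 2) ω)) (ε' (m + 2)) μ :=
    indepFun_of_measurable_comap h1 ((measurable_path hF hX (measurable_fst.comp hG)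
      fun t ht _ => hGε t ht).prodMk (hGε _ (by omega)))
  have h3 := ae_ae_of_indepFun (hpath.prodMk hεm).aemeasurable hident.aemeasurable_fst h2
    (p := fun z => dist (F (m + 2) (z.1.1 (Fin.last m), z.1.2))
      (F (m + 2) (z.1.1 (Fin.last m), z.2)) ≤ c)
    (measurableSet_le (by fun_prop) measurable_const) h
  rw [hident.map_eq, (indepFun_iff_map_prod_eq_prod_map_map hpath.aemeasurable
    hεm.aemeasurable).1 (indepFun_path_innovation hF hX hX1 hε hε_indep hX1ε m)] at h3
  have := Measure.isProbabilityMeasure_map (μ := μ) hεm.aemeasurable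
  exact Measure.ae_ae_of_ae_prod h3

lemma sum_Icc_one_eq_sum_range (g : ℕ → ℝ) (m : ℕ) :
    ∑ k ∈ Finset.Icc 1 (m + 1), g k = ∑ k ∈ Finset.range (m + 1), g (k + 1) := by
  rw [Finset.range_eq_Ico, Finset.sum_Ico_add' g 0 (m + 1) 1]
  rfl

end MarkovMcDiarmid

end

/-! ### Assembly: from laws of trajectories to the random variables on `Ω` -/

theorem proposition2
    {Ω 𝒳 𝒴 : Type*}
    [MeasurableSpace Ω] (μ : Measure Ω) [IsProbabilityMeasure μ]
    [MetricSpace 𝒳] [CompleteSpace 𝒳] [TopologicalSpace.SeparableSpace 𝒳]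
    [MeasurableSpace 𝒳] [BorelSpace 𝒳]
    [MetricSpace 𝒴] [CompleteSpace 𝒴] [TopologicalSpace.SeparableSpace 𝒴]
    [MeasurableSpace 𝒴] [BorelSpace 𝒴]
    -- the initial state `X 1` and the i.i.d. innovations `ε 2, ε 3, …`
    (X : ℕ → Ω → 𝒳) (ε : ℕ → Ω → 𝒴)
    (hX1 : Measurable (X 1))
    (hε : ∀ t, 2 ≤ t → Measurable (ε t))
    (hε_indep : iIndepFun (fun t : Set.Ici (2 : ℕ) => ε t) μ)
    (hε_ident : ∀ t, 2 ≤ t → IdentDistrib (ε t) (ε 2) μ μ)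
    (hX1ε : IndepFun (X 1) (MarkovMcDiarmid.innov ε) μ)
    -- the chain `X_t = F_t(X_{t-1}, ε_t)`
    (F : ℕ → 𝒳 × 𝒴 → 𝒳)
    (hF : ∀ t, 2 ≤ t → Measurable (F t))
    (hX : ∀ t, 2 ≤ t → ∀ ω, X t ω = F t (X (t - 1) ω, ε t ω))
    -- one-step contraction in mean
    (ρ : ℝ) (hρ0 : 0 ≤ ρ) (hρ1 : ρ < 1)
    (hcontract : ∀ t, 2 ≤ t → ∀ x x' : 𝒳,
      ∫⁻ ω, edist (F t (x, ε t ω)) (F t (x', ε t ω)) ∂μ ≤ ENNReal.ofReal ρ * edist x x')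
    -- an independent copy `(X1', (ε'_t)_{t ≥ 2})` of `(X_1, (ε_t)_{t ≥ 2})`
    (X1' : Ω → 𝒳) (ε' : ℕ → Ω → 𝒴)
    (hcopy_ident : IdentDistrib (fun ω => (X1' ω, MarkovMcDiarmid.innov ε' ω))
      (fun ω => (X 1 ω, MarkovMcDiarmid.innov ε ω)) μ μ)
    (hcopy_indep : IndepFun (fun ω => (X1' ω, MarkovMcDiarmid.innov ε' ω))
      (fun ω => (X 1 ω, MarkovMcDiarmid.innov ε ω)) μ)
    -- the separately Lipschitz function `f`
    (n : ℕ) (hn : 1 ≤ n)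
    (f : (Fin n → 𝒳) → ℝ)
    (hf : ∀ x x' : Fin n → 𝒳, |f x - f x'| ≤ ∑ t, dist (x t) (x' t))
    -- the bounds on the increments
    (M : ℕ → ℝ) (hM : ∀ k ∈ Finset.Icc 1 n, 0 < M k)
    (hM1 : eLpNorm (fun ω => dist (X 1 ω) (X1' ω)) ∞ μ ≤ ENNReal.ofReal (M 1))
    (hMk : ∀ k ∈ Finset.Icc 2 n,
      eLpNorm (fun ω => dist (F k (X (k - 1) ω, ε k ω)) (F k (X (k - 1) ω, ε' k ω))) ∞ μ
        ≤ ENNReal.ofReal (M k)) :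
    -- `S_n` is well defined
    Integrable (fun ω => f (MarkovMcDiarmid.path n X ω)) μ ∧
    -- for each choice of the sign `σ = ±1`:
    ∀ σ : ℝ, (σ = 1 ∨ σ = -1) →
      -- the bound on the Laplace transform
      (∀ s : ℝ, 0 ≤ s →
        Integrable (fun ω => Real.exp (σ * s * MarkovMcDiarmid.S μ n X f ω)) μ ∧
        ∫ ω, Real.exp (σ * s * MarkovMcDiarmid.S μ n X f ω) ∂μ
          ≤ Real.exp ((MarkovMcDiarmid.D n ρ M) ^ 2 / MarkovMcDiarmid.Msq n ρ M *
              MarkovMcDiarmid.ell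
                (MarkovMcDiarmid.Msq n ρ M * s / MarkovMcDiarmid.D n ρ M))) ∧
      -- the two successive tail bounds
      (∀ x ∈ Set.Icc (0 : ℝ) (MarkovMcDiarmid.D n ρ M),
        μ {ω | x < σ * MarkovMcDiarmid.S μ n X f ω}
          ≤ EReal.exp (-((((MarkovMcDiarmid.D n ρ M) ^ 2 / MarkovMcDiarmid.Msq n ρ M : ℝ) : EReal) *
              MarkovMcDiarmid.ellStar (x / MarkovMcDiarmid.D n ρ M))) ∧
        EReal.exp (-((((MarkovMcDiarmid.D n ρ M) ^ 2 / MarkovMcDiarmid.Msq n ρ M : ℝ) : EReal) *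
              MarkovMcDiarmid.ellStar (x / MarkovMcDiarmid.D n ρ M)))
          ≤ ENNReal.ofReal (((MarkovMcDiarmid.D n ρ M - x) / MarkovMcDiarmid.D n ρ M) ^
              ((2 * MarkovMcDiarmid.D n ρ M * x - x ^ 2) / MarkovMcDiarmid.Msq n ρ M))) := by
  open MarkovMcDiarmid in
  have : SecondCountableTopology 𝒳 := UniformSpace.secondCountable_of_separable 𝒳
  obtain ⟨m, rfl⟩ : ∃ m, n = m + 1 := ⟨n - 1, by omega⟩
  have hpath : ∀ k, Measurable (path (k + 1) X) := fun k =>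
    measurable_path hF hX hX1 fun t ht _ => hε t ht
  have hν : ∀ k, μ.map (ε (k + 2)) = μ.map (ε 2) := fun k => (hε_ident (k + 2) (by omega)).map_eq
  have hPprob : ∀ k, IsProbabilityMeasure (μ.map (path (k + 1) X)) := fun k =>
    Measure.isProbabilityMeasure_map (hpath k).aemeasurable
  have hνprob : IsProbabilityMeasure (μ.map (ε 2)) :=
    Measure.isProbabilityMeasure_map (hε 2 le_rfl).aemeasurable
  have hP : ∀ k, μ.map (path (k + 2) X)
      = ((μ.map (path (k + 1) X)).prod (μ.map (ε 2))).map (extend (F (k + 2))) := by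
    intro k
    rw [← hν k, ← (indepFun_iff_map_prod_eq_prod_map_map (hpath k).aemeasurable
      (hε (k + 2) (by omega)).aemeasurable).1
      (indepFun_path_innovation hF hX hX1 hε hε_indep hX1ε k),
      Measure.map_map (measurable_extend (hF _ (by omega)))
      ((hpath k).prodMk (hε (k + 2) (by omega)))]
    congr 1
    exact funext (path_succ hX k)
  have hc : ∀ k x x', ∫⁻ y, edist (F (k + 2) (x, y)) (F (k + 2) (x', y)) ∂(μ.map (ε 2))
      ≤ ENNReal.ofReal ρ * edist x x' := by
    intro k x x'
    have hFk := hF (k + 2) (by omega)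
    rw [← hν k, lintegral_map (by fun_prop) (hε (k + 2) (by omega))]
    exact hcontract (k + 2) (by omega) x x'
  have hb0 : ∀ᵐ x ∂(μ.map (path 1 X)), ∀ᵐ x' ∂(μ.map (path 1 X)),
      dist (x 0) (x' 0) ≤ M 1 := by
    have hcoord : Measurable (fun z : 𝒳 × (Set.Ici (2 : ℕ) → 𝒴) => fun _ : Fin 1 => z.1) := by
      fun_prop
    have hpath1 : path 1 X = fun ω (_ : Fin 1) => X 1 ω := by
      funext ω i
      simp [path]
    have hident : IdentDistrib (fun ω (_ : Fin 1) => X1' ω) (path 1 X) μ μ := by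
      rw [hpath1]; exact hcopy_ident.comp hcoord
    have hind : IndepFun (path 1 X) (fun ω (_ : Fin 1) => X1' ω) μ := by
      rw [hpath1]; exact (hcopy_indep.comp hcoord hcoord).symm
    have h := ae_ae_of_indepFun (hpath 0).aemeasurable hident.aemeasurable_fst hind
      (p := fun z => dist (z.1 0) (z.2 0) ≤ M 1)
      (measurableSet_le (by fun_prop) measurable_const)
      (ae_le_of_eLpNorm_top_le (hM 1 (by simp)).le hM1)
    rwa [hident.map_eq] at h
  have hbs : ∀ k < m, ∀ᵐ x ∂(μ.map (path (k + 1) X)), ∀ᵐ y ∂(μ.map (ε 2)),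
      ∀ᵐ y' ∂(μ.map (ε 2)),
      dist (F (k + 2) (x (Fin.last k), y)) (F (k + 2) (x (Fin.last k), y')) ≤ M (k + 2) := by
    intro k hk
    have h := ae_dist_transition_le hF hX hX1 hε hε_indep hX1ε hcopy_ident hcopy_indep k
      (ae_le_of_eLpNorm_top_le (hM (k + 2) (by rw [Finset.mem_Icc]; omega)).le
        (hMk (k + 2) (by rw [Finset.mem_Icc]; omega)))
    rwa [hν k] at h
  -- Step `k` leads from length `k + 1` to `k + 2`, hence `F (k + 2)` and `M (k + 1)`; `j = 0` since
  -- nothing has been integrated out yet.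
  have main := fun g hg => integrable_and_lintegral_exp_le (fun k => μ.map (path (k + 1) X))
    (μ.map (ε 2)) (fun k => F (k + 2)) (fun k => hF _ (by omega)) hP hρ0 hρ1 hc
    (fun k => M (k + 1)) m (fun k hk => hM _ (by rw [Finset.mem_Icc]; omega)) hb0 hbs m le_rfl 0
    g hg
  -- Both signs are covered at once, since `-f` has the same Lipschitz property as `f`.
  have hfL : ∀ σ : ℝ, |σ| = 1 → SepLipschitz (K ρ 0) (fun x => σ * f x) := by
    intro σ hσ x x'
    rw [← mul_sub, abs_mul, hσ, one_mul, K_zero hρ1, one_mul, ← Fin.sum_univ_castSucc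
      (f := fun i => dist (x i) (x' i))]
    exact hf x x'
  have hfm : Measurable f := by
    have := (hfL 1 (by simp)).continuous (K_pos hρ0 hρ1 0).le
    simp only [one_mul] at this
    exact this.measurable
  have hfi : Integrable (fun ω => f (path (m + 1) X ω)) μ := by
    have := (main _ (hfL 1 (by simp))).1
    simp only [one_mul] at this
    exact (integrable_map_measure hfm.aestronglyMeasurable (hpath m).aemeasurable).1 this
  have hΔ : ∀ k ∈ Finset.range (m + 1), 0 < K ρ (m - k) * M (k + 1) := fun k hk =>
    mul_pos (K_pos hρ0 hρ1 _) (hM _ (by rw [Finset.mem_range] at hk; rw [Finset.mem_Icc]; omega))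
  have hDsum : D (m + 1) ρ M = ∑ k ∈ Finset.range (m + 1), K ρ (m - k) * M (k + 1) := by
    rw [D, sum_Icc_one_eq_sum_range]
    simp only [Nat.add_sub_add_right]
  have hVsum : Msq (m + 1) ρ M = ∑ k ∈ Finset.range (m + 1), (K ρ (m - k) * M (k + 1)) ^ 2 := by
    rw [Msq, sum_Icc_one_eq_sum_range]
    simp only [Nat.add_sub_add_right]
  have hne : (Finset.range (m + 1)).Nonempty := Finset.nonempty_range_add_one
  have hD : 0 < D (m + 1) ρ M := hDsum ▸ Finset.sum_pos hΔ hne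
  have hV : 0 < Msq (m + 1) ρ M :=
    hVsum ▸ Finset.sum_pos (fun k hk => pow_pos (hΔ k hk) 2) hne
  refine ⟨hfi, fun σ hσ => ?_⟩
  have hσ1 : |σ| = 1 := by rcases hσ with rfl | rfl <;> simp
  have hSm : Measurable (S μ (m + 1) X f) := (hfm.comp (hpath m)).sub_const _
  have hlap : ∀ s : ℝ, 0 ≤ s →
      ∫⁻ ω, ENNReal.ofReal (Real.exp (s * (σ * S μ (m + 1) X f ω))) ∂μ
        ≤ ENNReal.ofReal (Real.exp ((D (m + 1) ρ M) ^ 2 / Msq (m + 1) ρ M *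
          ell (Msq (m + 1) ρ M * s / D (m + 1) ρ M))) := by
    intro s hs
    have h1 := (main _ (hfL σ hσ1)).2 s hs
    rw [lintegral_map (by fun_prop) (hpath m), integral_const_mul,
      integral_map (hpath m).aemeasurable hfm.aestronglyMeasurable] at h1
    simp only [← mul_sub] at h1
    refine h1.trans (ENNReal.ofReal_le_ofReal (Real.exp_le_exp.2 ?_))
    rw [hDsum, hVsum]
    exact sum_ell_le _ hne _ hΔ hs
  have hint : ∀ s : ℝ, 0 ≤ s →
      Integrable (fun ω => Real.exp (s * (σ * S μ (m + 1) X f ω))) μ := by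
    intro s hs
    refine ⟨(by fun_prop : Measurable _).aestronglyMeasurable, ?_⟩
    rw [hasFiniteIntegral_iff_ofReal (Filter.Eventually.of_forall fun _ => (Real.exp_pos _).le)]
    exact (hlap s hs).trans_lt ENNReal.ofReal_lt_top
  have hmgf : ∀ s : ℝ, 0 ≤ s → ∫ ω, Real.exp (s * (σ * S μ (m + 1) X f ω)) ∂μ
      ≤ Real.exp ((D (m + 1) ρ M) ^ 2 / Msq (m + 1) ρ M *
          ell (Msq (m + 1) ρ M * s / D (m + 1) ρ M)) := by
    intro s hs
    rw [← ENNReal.ofReal_le_ofReal_iff (Real.exp_pos _).le,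
      ofReal_integral_eq_lintegral_ofReal (hint s hs)
        (Filter.Eventually.of_forall fun _ => (Real.exp_pos _).le)]
    exact hlap s hs
  refine ⟨fun s hs => ?_, fun x hx => ⟨measure_lt_le_exp_neg_ellStar hD hV hint hmgf x, ?_⟩⟩
  · have e : ∀ ω, σ * s * S μ (m + 1) X f ω = s * (σ * S μ (m + 1) X f ω) := fun ω => by ring
    simp only [e]
    exact ⟨hint s hs, hmgf s hs⟩
  · refine (exp_neg_ellStar_le (div_nonneg hx.1 hD.le) ((div_le_one hD).2 hx.2)
      (by positivity : 0 < (D (m + 1) ρ M) ^ 2 / Msq (m + 1) ρ M)).trans (le_of_eq ?_)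
    congr 2
    · field_simp
    · field_simp
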